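/- **Lemma 3.4 (symmetric approximation).** Throughout, $\|\cdot\|$ is the spectral norm and $\|\cdot\|_F$ the Frobenius norm. Let $n,\tau,r,p\ge 1$ and $0\le\tilde r\le r$ be integers, $\epsilon\in(0,1]$, $\delta\in(0,1/2]$, and put $$\kappa=\frac{\epsilon}{300r^2(\tau+1)},\qquad \epsilon_s=\frac{\epsilon}{400r^2}.$$ Let $A=A_1+\dots+A_\tau$, where each $A_\ell\in\mathbb C^{n\times n}$ is Hermitian with $\|A_\ell\|\le 1$ and $\operatorname{rank}(A_\ell)\le r$. Let $V\in\mathbb C^{n\times\tilde r}$ be such that some isometry $W\in\mathbb C^{n\times\tilde r}$ with the same column space as $V$ satisfies $\|W-V\|_F\le\kappa$, and such that $$\|VV^\dagger AVV^\dagger-A\|_F\le\frac{\epsilon}{300r^2}\,(2+\kappa).$$ Suppose that the $A_\ell$ can be accessed in time $1+\log n$ per operation: sampling a row index $i$ with probability $\|A_\ell(i,\cdot)\|^2/\|A_\ell\|_F^2$; for given $i$, sampling $j$ with probability $|A_\ell(i,j)|^2/\|A_\ell(i,\cdot)\|^2$; querying an entry, a row norm or the Frobenius norm of $A_\ell$.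 Suppose that entries of $V$ can be queried in time $p$ each. There is a randomized algorithm (one fixed program for a random access machine with unit-cost integer arithmetic and exact unit-cost complex arithmetic, which gets $n,\tau,\tilde r,r,\epsilon,\delta$ as input, sees the matrices only through the above operations, and ends by diagonalizing an $\tilde r\times\tilde r$ Hermitian matrix in time $\tilde r^3$) such that with probability at least $1-\delta$, within total time (queries and samples included) $$O\Bigl((p+\log n)\,\frac{r^5\tau^3}{\epsilon_s^2}\,\log\frac1\delta\Bigr)$$ with an absolute implied constant, it outputs a Hermitian matrix $\tilde B\in\mathbb C^{\tilde r\times\tilde r}$ with $\|V^\dagger AV-\tilde B\|_F\le\epsilon_s$ and a spectral decomposition $\tilde B=UDU^\dagger$ ($U$ unitary, $D$ real diagonal), and $$\|V\tilde BV^\dagger-A\|\le\Bigl(1+\frac{\epsilon}{300r^2(\tau+1)}\Bigr)^2\frac{\epsilon}{400r^2}+\Bigl(2+\frac{\epsilon}{300r^2(\tau+1)}\Bigr)\frac{\epsilon}{300r^2}.$$ Moreover $(VU)D(VU)^\dagger$ is then an approximate spectral decomposition of $A$: $\|(VU)D(VU)^\dagger-A\|$ satisfies the same bound, and there is an isometry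 with the same column space as $VU$ within Frobenius distance $\kappa$ of $VU$. -/

import Mathlib

open scoped Matrix Matrix.Norms.L2Operator

-- With the scoped instances just opened, the norm `‖M‖` of a (rectangular) complex matrix is its
-- spectral norm, that is, its operator norm between Euclidean spaces.

namespace SymApprox

noncomputable section

/-- The Frobenius norm of a complex matrix. -/
def frobNorm {a b : ℕ} (M : Matrix (Fin a) (Fin b) ℂ) : ℝ :=
  Real.sqrt (∑ i, ∑ j, ‖M i j‖ ^ 2)

/-- The Euclidean norm of the `i`-th row of a complex matrix. -/
def rowNorm {a b : ℕ} (M : Matrix (Fin a) (Fin b) ℂ) (i : Fin a) : ℝ :=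
  Real.sqrt (∑ j, ‖M i j‖ ^ 2)

/-- The probability that sampling a row index of `M` returns `i`.
(For `M = 0` all these numbers are `0`: sampling from the zero matrix never succeeds.) -/
def rowProb {n : ℕ} (M : Matrix (Fin n) (Fin n) ℂ) (i : Fin n) : ℝ :=
  rowNorm M i ^ 2 / frobNorm M ^ 2

/-- The probability that sampling an index from the row `i` of `M` returns `j`.
(For a zero row all these numbers are `0`: sampling from it never succeeds.) -/
def entryProb {n : ℕ} (M : Matrix (Fin n) (Fin n) ℂ) (i j : Fin n) : ℝ :=
  ‖M i j‖ ^ 2 / rowNorm M i ^ 2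

/-- `V` is within Frobenius distance `κ` of an isometry that has the same column space. -/
def NearIsometry {n k : ℕ} (V : Matrix (Fin n) (Fin k) ℂ) (κ : ℝ) : Prop :=
  ∃ W : Matrix (Fin n) (Fin k) ℂ, Wᴴ * W = 1 ∧
    LinearMap.range W.mulVecLin = LinearMap.range V.mulVecLin ∧ frobNorm (W - V) ≤ κ

/-! ### A random access machine with sampling and query access to matrices

The machine has integer registers `x 0, x 1, …` holding natural numbers and number registers
`c 0, c 1, …` holding complex numbers.  Integer registers are named directly; number registers are
addressed indirectly, through the contents of integer registers.  The data (the matrices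
`A 0, …, A (τ - 1)` and `V`) can be accessed only through the sampling and query instructions. -/

/-- What a program has access to: `n × n` matrices `A ℓ` that can be sampled and queried, and an
`n × k` matrix `V` that can be queried, each query to `V` taking time `p`. -/
structure Access (n τ k : ℕ) where
  A : Fin τ → Matrix (Fin n) (Fin n) ℂ
  V : Matrix (Fin n) (Fin k) ℂ
  p : ℕ

/-- The state of the machine: the registers, and the time `t` elapsed so far. -/
structure State where
  x : ℕ → ℕ
  c : ℕ → ℂ
  t : ℝ

/-- Write to an integer register. -/
def State.setInt (s : State) (d v : ℕ) : State := { s with x := Function.update s.x d v }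

/-- Write to the number register whose address is in the integer register `d`. -/
def State.setNum (s : State) (d : ℕ) (z : ℂ) : State :=
  { s with c := Function.update s.c (s.x d) z }

/-- The contents of the number register whose address is in the integer register `a`. -/
def State.num (s : State) (a : ℕ) : ℂ := s.c (s.x a)

/-- Let time pass. -/
def State.tick (s : State) (q : ℝ) : State := { s with t := s.t + q }

/-- Operations on natural numbers (subtraction is truncated). -/
inductive IntOp where
  | add | sub | mul

/-- The value of an operation on natural numbers. -/
def IntOp.eval : IntOp → ℕ → ℕ → ℕ
  | .add, a, b => a + b
  | .sub, a, b => a - b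
  | .mul, a, b => a * b

/-- The four field operations (division by zero gives zero). -/
inductive NumOp where
  | add | sub | mul | div

/-- The value of a field operation. -/
def NumOp.eval : NumOp → ℂ → ℂ → ℂ
  | .add, z, w => z + w
  | .sub, z, w => z - w
  | .mul, z, w => z * w
  | .div, z, w => z / w

/-- The instructions.  All arguments (except the constant `v`) are names of integer registers.
In an integer-valued instruction (`const`, `int`, `coin`, `sampleRow`, `sampleEntry`) the result is
put into the integer register `d`, in a number-valued one into the number register addressed
by `d`. -/
inductive Instr where
  /-- load the constant `v` -/
  | const (d v : ℕ)
  /-- integer arithmetic -/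
  | int (op : IntOp) (d a b : ℕ)
  /-- flip a fair coin, the result being `0` or `1` -/
  | coin (d : ℕ)
  /-- convert the integer in `a` to a complex number -/
  | cast (d a : ℕ)
  /-- arithmetic on the numbers addressed by `a` and `b` -/
  | num (op : NumOp) (d a b : ℕ)
  /-- complex conjugate of the number addressed by `a` -/
  | conj (d a : ℕ)
  /-- sample a row index of the matrix `A ℓ`, with `ℓ` in register `l` -/
  | sampleRow (d l : ℕ)
  /-- sample an index from the row `i` of `A ℓ`, with `ℓ`, `i` in registers `l`, `i` -/
  | sampleEntry (d l i : ℕ)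
  /-- query the entry `A ℓ (i, j)` -/
  | entry (d l i j : ℕ)
  /-- query the norm of the row `i` of `A ℓ` -/
  | rowNorm (d l i : ℕ)
  /-- query the Frobenius norm of `A ℓ` -/
  | frob (d l : ℕ)
  /-- query the entry `V (i, j)` -/
  | entryV (d i j : ℕ)

/-- The time taken by an instruction: `p` for a query to `V`, `1 + log n` for any access to the
`A ℓ`, and `1` for everything else. -/
def Instr.cost {n τ k : ℕ} (O : Access n τ k) : Instr → ℝ
  | .const _ _ | .int _ _ _ _ | .coin _ | .cast _ _ | .num _ _ _ _ | .conj _ _ => 1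
  | .sampleRow _ _ | .sampleEntry _ _ _ | .entry _ _ _ _ | .rowNorm _ _ _ | .frob _ _ =>
      1 + Real.log n
  | .entryV _ _ _ => O.p

open Classical in
/-- The expectation of `F` at the state reached by an instruction from the state `s`.  An
instruction that refers to a matrix, a row or a column that does not exist, or that samples from a
zero matrix or from a zero row, makes the run fail; a failed run contributes `0`. -/
def Instr.run {n τ k : ℕ} (O : Access n τ k) (I : Instr) (F : State → ℝ) (s₀ : State) : ℝ :=
  let s := s₀.tick (I.cost O)
  match I with
  | .const d v => F (s.setInt d v)
  | .int op d a b => F (s.setInt d (op.eval (s.x a) (s.x b)))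
  | .coin d => (F (s.setInt d 0) + F (s.setInt d 1)) / 2
  | .cast d a => F (s.setNum d (s.x a : ℂ))
  | .num op d a b => F (s.setNum d (op.eval (s.num a) (s.num b)))
  | .conj d a => F (s.setNum d (star (s.num a)))
  | .sampleRow d l =>
      if h : s.x l < τ then
        ∑ i : Fin n, rowProb (O.A ⟨s.x l, h⟩) i * F (s.setInt d i)
      else 0
  | .sampleEntry d l i =>
      if h : s.x l < τ ∧ s.x i < n then
        ∑ j : Fin n, entryProb (O.A ⟨s.x l, h.1⟩) ⟨s.x i, h.2⟩ j * F (s.setInt d j)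
      else 0
  | .entry d l i j =>
      if h : s.x l < τ ∧ s.x i < n ∧ s.x j < n then
        F (s.setNum d (O.A ⟨s.x l, h.1⟩ ⟨s.x i, h.2.1⟩ ⟨s.x j, h.2.2⟩))
      else 0
  | .rowNorm d l i =>
      if h : s.x l < τ ∧ s.x i < n then
        F (s.setNum d (SymApprox.rowNorm (O.A ⟨s.x l, h.1⟩) ⟨s.x i, h.2⟩ : ℝ))
      else 0
  | .frob d l =>
      if h : s.x l < τ then F (s.setNum d (frobNorm (O.A ⟨s.x l, h⟩) : ℝ)) else 0
  | .entryV d i j =>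
      if h : s.x i < n ∧ s.x j < k then F (s.setNum d (O.V ⟨s.x i, h.1⟩ ⟨s.x j, h.2⟩)) else 0

/-- Tests: comparison of two integer registers, or of the real parts of the numbers addressed by
two integer registers. -/
inductive Test where
  | intLt (a b : ℕ)
  | numLe (a b : ℕ)

/-- The meaning of a test. -/
def Test.Holds : Test → State → Prop
  | .intLt a b, s => s.x a < s.x b
  | .numLe a b, s => (s.num a).re ≤ (s.num b).re

/-- Programs: finite texts, built from the instructions with branching and while-loops. -/
inductive Prog where
  | instr (I : Instr)
  | seq (P Q : Prog)
  | cond (b : Test) (P Q : Prog)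
  | loop (b : Test) (P : Prog)

open Classical in
/-- The while-loop with test `b` and body `body`, all runs with more than `m - 1` rounds being
counted as failed.  Each evaluation of the test takes time `1`. -/
def unroll (b : Test) (body : (State → ℝ) → State → ℝ) (F : State → ℝ) : ℕ → State → ℝ
  | 0, _ => 0
  | m + 1, s =>
      if b.Holds s then body (unroll b body F m) (s.tick 1) else F (s.tick 1)

open Classical in
/-- The expectation of `F` at the final state of a program started in a given state, where a run
that fails, or one of whose loops makes `fuel` rounds or more, contributes `0`. -/
def Prog.run {n τ k : ℕ} (O : Access n τ k) (fuel : ℕ) :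
    Prog → (State → ℝ) → State → ℝ
  | .instr I, F => I.run O F
  | .seq P Q, F => P.run O fuel (Q.run O fuel F)
  | .cond b P Q, F => fun s =>
      if b.Holds s then P.run O fuel F (s.tick 1) else Q.run O fuel F (s.tick 1)
  | .loop b P, F => unroll b (P.run O fuel) F fuel

/-- The state at the start: the integer registers `0, …, 3` hold `n`, `τ`, `k`, `r`, the number
registers `0`, `1` hold `ε`, `δ`, and all other registers hold zero. -/
def State.start (n τ k r : ℕ) (ε δ : ℝ) : State where
  x a := if a = 0 then n else if a = 1 then τ else if a = 2 then k else if a = 3 then r else 0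
  c a := if a = 0 then (ε : ℂ) else if a = 1 then (δ : ℂ) else 0
  t := 0

/-- The `k × k` matrix left by a program: its entries are in consecutive number registers, row by
row, the address of the first one being in the integer register `0`. -/
def State.result (s : State) (k : ℕ) : Matrix (Fin k) (Fin k) ℂ :=
  Matrix.of fun i j => s.c (s.x 0 + (i : ℕ) * k + (j : ℕ))

open Classical in
/-- A *symmetric approximation* first runs a program, which leaves a `k × k` matrix `B`, and then
computes a spectral decomposition `B = U D U†`, which takes time `k ^ 3`; its output is `B`, `U` and
(the diagonal of) `D`.  The predicate says: with probability at least `q`, the whole computation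
halts after a time of at most `T`, the matrix `B` is Hermitian, and the output satisfies `good`.
(The probability of this event among the runs whose loops make less than `fuel` rounds increases
to the probability of the event as `fuel` grows.) -/
def Prog.Succeeds {n τ k : ℕ} (P : Prog) (O : Access n τ k) (r : ℕ) (ε δ q T : ℝ)
    (good : Matrix (Fin k) (Fin k) ℂ → Matrix (Fin k) (Fin k) ℂ → (Fin k → ℝ) → Prop) : Prop :=
  ∃ fuel : ℕ, q ≤ P.run O fuel (fun s =>
    if ∃ h : (s.result k).IsHermitian,
      s.t + (k : ℝ) ^ 3 ≤ T ∧ good (s.result k) h.eigenvectorUnitary h.eigenvalues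
    then 1 else 0) (State.start n τ k r ε δ)

end

end SymApprox

/-! The algorithm is importance sampling with truncation. If `(a, b)` is drawn with probability
`|A_ab|² / ‖A‖_F²`, then `(‖A‖_F² / conj A_ab) · conj (V_ai) · V_bj` is an unbiased estimator of the
`(i, j)` entry of `Vᴴ A V`. So is its Hermitian part, because `A` is Hermitian. The second moment in
Frobenius norm is at most `‖A‖_F² ‖V‖_F⁴`. This is at most `σ² = 4r³`, since `‖A‖_F² ≤ r` by the
rank and norm bounds and `‖V‖_F² ≤ 2r` by near isometry.

A second moment alone would cost a factor `1/δ`. For `log (1/δ)`, an estimate of norm above `B =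
8r³τ/ε_s` is replaced by zero. The resulting bias is at most `σ²/B` per matrix
(`frobNorm_sub_clipMean_le`), hence at most `ε_s/2` in total. The fluctuation is controlled without
dependence on the dimension: in an inner product space, adding a centred vector multiplies the mean
of `cosh (λ‖·‖)` by at most `1 + λ²σ²` (`sum_cosh_norm_add_sub_mean_le`). With `M` samples from each
`A_ℓ`, Markov's inequality at level `M ε_s/2` gives failure probability at most `(1 + λ²σ²)^(τM) /
cosh (λ M ε_s/2)`. For `λ = ε_s/(16r³τ)` and `M` of order `r³τ ε_s⁻² log (1/δ)` this is at most `δ`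
(`failure_le`).

Probability and program are joined by a Hoare logic whose assertions carry a real number, a lower
bound for the expectation still to come. Deterministic instructions keep it and sampling
instructions average it. The number carried is at most `potential`, that is, 1 minus the current
Markov bound. Its one-step inequality is `potential_le`, and at the end it is positive only for good
outcomes. The time is tracked by the same assertions.

The spectral norm bounds follow deterministically from `‖Vᴴ A V - B‖_F ≤ ε_s`
(`norm_compress_sub_le`), and passing from `V` to `VU` is harmless because `U` is unitary. -/

namespace SymApprox

/-! ### A program logic for lower bounds on expectations -/

/-- `Triple O fuel P s v Q`: the expectation of `F` after running `P` from `s` is at least `v`,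
for every `F` that is at least `v'` at `s'` whenever `Q s' v'`. -/
def Triple {n τ k : ℕ} (O : Access n τ k) (fuel : ℕ) (P : Prog) (s : State) (v : ℝ)
    (Q : State → ℝ → Prop) : Prop :=
  ∀ F : State → ℝ, (∀ s' v', Q s' v' → v' ≤ F s') → v ≤ P.run O fuel F s

namespace Triple

variable {n τ k : ℕ} {O : Access n τ k} {fuel : ℕ} {s : State} {v : ℝ} {Q : State → ℝ → Prop}

theorem mono {P : Prog} {R : State → ℝ → Prop} (h : Triple O fuel P s v R)
    (hRQ : ∀ s' v', R s' v' → Q s' v') : Triple O fuel P s v Q :=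
  fun F hF => h F fun s' v' h' => hF s' v' (hRQ s' v' h')

/-- `Prog.run` is in continuation style, so the triple for the second program can itself serve as
the postcondition of the first. -/
theorem seq {P P' : Prog} (h : Triple O fuel P s v fun s' v' => Triple O fuel P' s' v' Q) :
    Triple O fuel (.seq P P') s v Q :=
  fun F hF => h _ fun _ _ h' => h' F hF

theorem seq_of {P P' : Prog} {R : State → ℝ → Prop} (h : Triple O fuel P s v R)
    (h' : ∀ s' v', R s' v' → Triple O fuel P' s' v' Q) : Triple O fuel (.seq P P') s v Q :=
  (h.mono h').seq

theorem const {d c : ℕ} (h : Q ((s.tick 1).setInt d c) v) :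
    Triple O fuel (.instr (.const d c)) s v Q := fun _ hF => hF _ _ h

theorem int {op : IntOp} {d a b : ℕ} (h : Q ((s.tick 1).setInt d (op.eval (s.x a) (s.x b))) v) :
    Triple O fuel (.instr (.int op d a b)) s v Q := fun _ hF => hF _ _ h

theorem cast {d a : ℕ} (h : Q ((s.tick 1).setNum d (s.x a : ℂ)) v) :
    Triple O fuel (.instr (.cast d a)) s v Q := fun _ hF => hF _ _ h

theorem num {op : NumOp} {d a b : ℕ}
    (h : Q ((s.tick 1).setNum d (op.eval (s.num a) (s.num b))) v) :
    Triple O fuel (.instr (.num op d a b)) s v Q := fun _ hF => hF _ _ h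

theorem conj {d a : ℕ} (h : Q ((s.tick 1).setNum d (star (s.num a))) v) :
    Triple O fuel (.instr (.conj d a)) s v Q := fun _ hF => hF _ _ h

theorem frob {d l : ℕ} (hl : s.x l < τ)
    (h : Q ((s.tick (1 + Real.log n)).setNum d (frobNorm (O.A ⟨s.x l, hl⟩) : ℝ)) v) :
    Triple O fuel (.instr (.frob d l)) s v Q := by
  intro F hF
  exact (hF _ _ h).trans_eq
    (by rw [Prog.run, Instr.run]; split; exacts [rfl, absurd hl ‹_›])

theorem entry {d l i j : ℕ} (hh : s.x l < τ ∧ s.x i < n ∧ s.x j < n)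
    (h : Q ((s.tick (1 + Real.log n)).setNum d
      (O.A ⟨s.x l, hh.1⟩ ⟨s.x i, hh.2.1⟩ ⟨s.x j, hh.2.2⟩)) v) :
    Triple O fuel (.instr (.entry d l i j)) s v Q := by
  intro F hF
  exact (hF _ _ h).trans_eq
    (by rw [Prog.run, Instr.run]; split; exacts [rfl, absurd hh ‹_›])

theorem entryV {d i j : ℕ} (hh : s.x i < n ∧ s.x j < k)
    (h : Q ((s.tick O.p).setNum d (O.V ⟨s.x i, hh.1⟩ ⟨s.x j, hh.2⟩)) v) :
    Triple O fuel (.instr (.entryV d i j)) s v Q := by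
  intro F hF
  exact (hF _ _ h).trans_eq
    (by rw [Prog.run, Instr.run]; split; exacts [rfl, absurd hh ‹_›])

theorem rowProb_nonneg (M : Matrix (Fin n) (Fin n) ℂ) (i : Fin n) : 0 ≤ rowProb M i := by
  unfold rowProb; positivity

theorem entryProb_nonneg (M : Matrix (Fin n) (Fin n) ℂ) (i j : Fin n) : 0 ≤ entryProb M i j := by
  unfold entryProb; positivity

/-- The only randomised rule form: the bound `v` may be redistributed over the outcomes as any `w`
whose weighted sum is at least `v`. Outcomes of probability zero carry no obligation, and total mass
1 is not needed. -/
theorem sampleRow {d l : ℕ} (hl : s.x l < τ) (w : Fin n → ℝ)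
    (hv : v ≤ ∑ i, rowProb (O.A ⟨s.x l, hl⟩) i * w i)
    (h : ∀ i, rowProb (O.A ⟨s.x l, hl⟩) i ≠ 0 →
      Q ((s.tick (1 + Real.log n)).setInt d i) (w i)) :
    Triple O fuel (.instr (.sampleRow d l)) s v Q := by
  intro F hF
  refine (hv.trans (Finset.sum_le_sum (g := fun i => rowProb (O.A ⟨s.x l, hl⟩) i * F ((s.tick (1 + Real.log n)).setInt d i))
    fun i _ => ?_)).trans_eq
    (by rw [Prog.run, Instr.run]; split; exacts [rfl, absurd hl ‹_›])
  by_cases hi : rowProb (O.A ⟨s.x l, hl⟩) i = 0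
  · rw [hi, zero_mul, zero_mul]
  · exact mul_le_mul_of_nonneg_left (hF _ _ (h i hi)) (rowProb_nonneg _ _)

theorem sampleEntry {d l r : ℕ} (hl : s.x l < τ ∧ s.x r < n) (w : Fin n → ℝ)
    (hv : v ≤ ∑ j, entryProb (O.A ⟨s.x l, hl.1⟩) ⟨s.x r, hl.2⟩ j * w j)
    (h : ∀ j, entryProb (O.A ⟨s.x l, hl.1⟩) ⟨s.x r, hl.2⟩ j ≠ 0 →
      Q ((s.tick (1 + Real.log n)).setInt d j) (w j)) :
    Triple O fuel (.instr (.sampleEntry d l r)) s v Q := by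
  intro F hF
  refine (hv.trans (Finset.sum_le_sum (g := fun j => entryProb (O.A ⟨s.x l, hl.1⟩) ⟨s.x r, hl.2⟩ j * F ((s.tick (1 + Real.log n)).setInt d j))
    fun j _ => ?_)).trans_eq
    (by rw [Prog.run, Instr.run]; split; exacts [rfl, absurd hl ‹_›])
  by_cases hj : entryProb (O.A ⟨s.x l, hl.1⟩) ⟨s.x r, hl.2⟩ j = 0
  · rw [hj, zero_mul, zero_mul]
  · exact mul_le_mul_of_nonneg_left (hF _ _ (h j hj)) (entryProb_nonneg _ _ _)

theorem cond {b : Test} {P P' : Prog} (h : b.Holds s → Triple O fuel P (s.tick 1) v Q)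
    (h' : ¬ b.Holds s → Triple O fuel P' (s.tick 1) v Q) :
    Triple O fuel (.cond b P P') s v Q := by
  intro F hF
  by_cases hb : b.Holds s
  · simpa only [Prog.run, if_pos hb] using h hb F hF
  · simpa only [Prog.run, if_neg hb] using h' hb F hF

/-- The rule for loops that make a known number of rounds. -/
theorem loop {b : Test} {P : Prog} (I : ℕ → State → ℝ → Prop) (m : ℕ) (hm : m < fuel)
    (h0 : I 0 s v)
    (hstep : ∀ i s v, i < m → I i s v → b.Holds s ∧ Triple O fuel P (s.tick 1) v (I (i + 1)))
    (hend : ∀ s v, I m s v → ¬ b.Holds s ∧ Q (s.tick 1) v) :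
    Triple O fuel (.loop b P) s v Q := by
  intro F hF
  -- Induction on the number `d` of rounds left. The inequality `d < f` is strict because the last,
  -- failing test also uses up one unit of fuel.
  have key : ∀ d i s v f, i + d = m → d < f → I i s v →
      v ≤ unroll b (P.run O fuel) F f s := by
    intro d
    induction d with
    | zero =>
      intro i s v f hi hf hI
      obtain ⟨f, rfl⟩ := Nat.exists_eq_succ_of_ne_zero (by omega : f ≠ 0)
      obtain rfl : i = m := hi
      obtain ⟨hb, hQ⟩ := hend s v hI
      simpa only [unroll, if_neg hb] using hF _ _ hQ
    | succ d ih =>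
      intro i s v f hi hf hI
      obtain ⟨f, rfl⟩ := Nat.exists_eq_succ_of_ne_zero (by omega : f ≠ 0)
      obtain ⟨hb, hT⟩ := hstep i s v (by omega) hI
      simp only [unroll, if_pos hb]
      exact hT _ fun s' v' h' => ih (i + 1) s' v' f (by omega) (by omega) h'
  simpa only [Prog.run] using key m 0 s v fuel (by omega) hm h0

end Triple

/-! ### An exponential moment bound in inner product spaces -/

/-- The function `t ↦ cosh √t` is convex, being the power series `∑ t^m / (2m)!` with nonnegative
coefficients. Convexity is applied term by term. -/
theorem cosh_le_of_sq_eq {θ u v w : ℝ} (h0 : 0 ≤ θ) (h1 : θ ≤ 1)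
    (hw : w ^ 2 = θ * u ^ 2 + (1 - θ) * v ^ 2) :
    Real.cosh w ≤ θ * Real.cosh u + (1 - θ) * Real.cosh v := by
  refine hasSum_le (fun m => ?_) (Real.hasSum_cosh w)
    (((Real.hasSum_cosh u).mul_left θ).add ((Real.hasSum_cosh v).mul_left (1 - θ)))
  have hc := (convexOn_pow m).2 (Set.mem_Ici.2 (sq_nonneg u)) (Set.mem_Ici.2 (sq_nonneg v)) h0
    (sub_nonneg.2 h1) (by ring)
  simp only [smul_eq_mul] at hc
  rw [← hw] at hc
  rw [← mul_div_assoc, ← mul_div_assoc, ← add_div]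
  simp only [pow_mul]
  gcongr

/-- For fixed norms, `‖x + y‖²` is affine in the inner product and runs between `(‖x‖ - ‖y‖)²` and
`(‖x‖ + ‖y‖)²`. Convexity of `cosh √t` bounds the value by interpolation between the collinear
cases, with `θ = (1 + cos angle) / 2`, and the addition formulas do the rest. -/
theorem cosh_norm_add_le {E : Type*} [NormedAddCommGroup E] [InnerProductSpace ℝ E] (x y : E) :
    Real.cosh ‖x + y‖ ≤ Real.cosh ‖x‖ * Real.cosh ‖y‖ +
      inner ℝ x y * (Real.sinh ‖x‖ / ‖x‖) * (Real.sinh ‖y‖ / ‖y‖) := by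
  rcases eq_or_ne x 0 with rfl | hx
  · simp
  rcases eq_or_ne y 0 with rfl | hy
  · simp
  have ha : 0 < ‖x‖ := norm_pos_iff.2 hx
  have hb : 0 < ‖y‖ := norm_pos_iff.2 hy
  have hab : 0 < ‖x‖ * ‖y‖ := mul_pos ha hb
  have habs := abs_le.1 (abs_real_inner_le_norm x y)
  set c := inner ℝ x y with hc
  have h1 : -1 ≤ c / (‖x‖ * ‖y‖) := by rw [le_div_iff₀ hab]; linarith
  have h2 : c / (‖x‖ * ‖y‖) ≤ 1 := by rw [div_le_iff₀ hab]; linarith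
  have h := cosh_le_of_sq_eq (θ := (1 + c / (‖x‖ * ‖y‖)) / 2) (u := ‖x‖ + ‖y‖) (v := ‖x‖ - ‖y‖)
    (w := ‖x + y‖) (by linarith) (by linarith)
    (by rw [norm_add_sq_real, ← hc]; field_simp; ring)
  refine h.trans (le_of_eq ?_)
  rw [Real.cosh_add, Real.cosh_sub]
  field_simp
  ring

variable {E ι : Type*} [NormedAddCommGroup E] [InnerProductSpace ℝ E] [Fintype ι]

/-- The part of the preceding bound linear in `Y` averages to zero. With `b = ‖Y‖`, what remains is
at most `cosh ‖x‖ · (cosh b + sinh b - b) = cosh ‖x‖ · (e^b - b)`, and `e^b ≤ 1 + b + b²` for `b ≤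
1`. -/
theorem sum_cosh_norm_add_le {p : ι → ℝ} (hp : ∀ i, 0 ≤ p i) (hp1 : ∑ i, p i = 1) {Y : ι → E}
    (hY : ∑ i, p i • Y i = 0) (hY1 : ∀ i, ‖Y i‖ ≤ 1) (x : E) :
    ∑ i, p i * Real.cosh ‖x + Y i‖ ≤ Real.cosh ‖x‖ * (1 + ∑ i, p i * ‖Y i‖ ^ 2) := by
  have hin : ∑ i, p i * inner ℝ x (Y i) = 0 := by
    have := congrArg (inner ℝ x) hY
    simpa [inner_sum, inner_smul_right] using this
  have hs : 0 ≤ Real.sinh ‖x‖ := Real.sinh_nonneg_iff.2 (norm_nonneg _)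
  have key : ∀ i, Real.cosh ‖x + Y i‖ ≤ Real.cosh ‖x‖ * (1 + ‖Y i‖ ^ 2) +
      (Real.sinh ‖x‖ / ‖x‖) * inner ℝ x (Y i) := by
    intro i
    refine (cosh_norm_add_le x (Y i)).trans ?_
    set b := ‖Y i‖ with hb
    have hb0 : 0 ≤ b := norm_nonneg _
    have hexp : Real.exp b ≤ 1 + b + b ^ 2 := by
      have := (abs_le.1 (Real.abs_exp_sub_one_sub_id_le (x := b)
        (by rw [abs_of_nonneg hb0]; exact hY1 i))).2
      linarith
    have hcs : Real.cosh b + Real.sinh b = Real.exp b := Real.cosh_add_sinh b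
    have hsb : b ≤ Real.sinh b := Real.self_le_sinh_iff.2 hb0
    have hch : Real.sinh ‖x‖ ≤ Real.cosh ‖x‖ := (Real.sinh_lt_cosh _).le
    have hcross : inner ℝ x (Y i) * (Real.sinh ‖x‖ / ‖x‖) * (Real.sinh b / b) ≤
        (Real.sinh ‖x‖ / ‖x‖) * inner ℝ x (Y i) + Real.sinh ‖x‖ * (Real.sinh b - b) := by
      rcases eq_or_lt_of_le hb0 with h0 | h0
      · have : Y i = 0 := norm_eq_zero.1 h0.symm
        simp [this, ← h0]
      rcases eq_or_ne x 0 with rfl | hx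
      · simp
      have ha : 0 < ‖x‖ := norm_pos_iff.2 hx
      have hle : inner ℝ x (Y i) ≤ ‖x‖ * b := real_inner_le_norm x (Y i)
      have e1 : inner ℝ x (Y i) * (Real.sinh ‖x‖ / ‖x‖) * (Real.sinh b / b) =
          (Real.sinh ‖x‖ / ‖x‖) * inner ℝ x (Y i) +
          inner ℝ x (Y i) * (Real.sinh ‖x‖ * (Real.sinh b - b) / (‖x‖ * b)) := by
        field_simp; ring
      rw [e1]
      have h3 : 0 ≤ Real.sinh ‖x‖ * (Real.sinh b - b) / (‖x‖ * b) :=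
        div_nonneg (mul_nonneg hs (by linarith)) (by positivity)
      have h4 := mul_le_mul_of_nonneg_right hle h3
      have h5 : ‖x‖ * b * (Real.sinh ‖x‖ * (Real.sinh b - b) / (‖x‖ * b)) =
          Real.sinh ‖x‖ * (Real.sinh b - b) := by field_simp
      linarith
    have h6 : Real.sinh ‖x‖ * (Real.sinh b - b) ≤ Real.cosh ‖x‖ * (Real.sinh b - b) :=
      mul_le_mul_of_nonneg_right hch (by linarith)
    have h7 : Real.cosh ‖x‖ * (Real.cosh b + Real.sinh b - b) ≤ Real.cosh ‖x‖ * (1 + b ^ 2) :=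
      mul_le_mul_of_nonneg_left (by linarith) (Real.cosh_pos _).le
    linarith
  calc ∑ i, p i * Real.cosh ‖x + Y i‖
      ≤ ∑ i, p i * (Real.cosh ‖x‖ * (1 + ‖Y i‖ ^ 2) +
          (Real.sinh ‖x‖ / ‖x‖) * inner ℝ x (Y i)) :=
        Finset.sum_le_sum fun i _ => mul_le_mul_of_nonneg_left (key i) (hp i)
    _ = Real.cosh ‖x‖ * (∑ i, p i + ∑ i, p i * ‖Y i‖ ^ 2) +
          (Real.sinh ‖x‖ / ‖x‖) * ∑ i, p i * inner ℝ x (Y i) := by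
        rw [← Finset.sum_add_distrib, Finset.mul_sum, Finset.mul_sum, ← Finset.sum_add_distrib]
        exact Finset.sum_congr rfl fun i _ => by ring
    _ = _ := by rw [hin, hp1]; ring

theorem sum_norm_sub_mean_sq_le {p : ι → ℝ} (hp1 : ∑ i, p i = 1) (Y : ι → E) :
    ∑ i, p i * ‖Y i - ∑ j, p j • Y j‖ ^ 2 ≤ ∑ i, p i * ‖Y i‖ ^ 2 := by
  set m := ∑ j, p j • Y j with hm
  have h : ∑ i, p i * inner ℝ (Y i) m = ‖m‖ ^ 2 := by
    rw [← real_inner_self_eq_norm_sq]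
    conv_rhs => rw [hm, sum_inner]
    simp [inner_smul_left, ← hm]
  have : ∑ i, p i * ‖Y i - m‖ ^ 2 = ∑ i, p i * ‖Y i‖ ^ 2 - ‖m‖ ^ 2 := by
    have : ∀ i, p i * ‖Y i - m‖ ^ 2 =
        p i * ‖Y i‖ ^ 2 - 2 * (p i * inner ℝ (Y i) m) + p i * ‖m‖ ^ 2 := by
      intro i; rw [norm_sub_sq_real]; ring
    simp_rw [this]
    rw [Finset.sum_add_distrib, Finset.sum_sub_distrib, ← Finset.mul_sum, h, ← Finset.sum_mul, hp1]
    ring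
  rw [this]
  linarith [sq_nonneg ‖m‖]

/-- One step of the exponential moment method for a sum of independent bounded vectors. -/
theorem sum_cosh_norm_add_sub_mean_le {p : ι → ℝ} (hp : ∀ i, 0 ≤ p i) (hp1 : ∑ i, p i = 1)
    {Y : ι → E} {B σ2 lam : ℝ} (hlam : 0 ≤ lam) (hB : ∀ i, ‖Y i‖ ≤ B) (hlB : 2 * lam * B ≤ 1)
    (hσ : ∑ i, p i * ‖Y i‖ ^ 2 ≤ σ2) (x : E) :
    ∑ i, p i * Real.cosh (lam * ‖x + Y i - ∑ j, p j • Y j‖) ≤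
      (1 + lam ^ 2 * σ2) * Real.cosh (lam * ‖x‖) := by
  set m := ∑ j, p j • Y j with hm
  have hmB : ‖m‖ ≤ B := by
    calc ‖m‖ ≤ ∑ j, ‖p j • Y j‖ := norm_sum_le _ _
      _ ≤ ∑ j, p j * B := Finset.sum_le_sum fun j _ => by
          rw [norm_smul, Real.norm_of_nonneg (hp j)]
          exact mul_le_mul_of_nonneg_left (hB j) (hp j)
      _ = B := by rw [← Finset.sum_mul, hp1, one_mul]
  -- Centring can double the norm bound `B`; this is the 2 in `2 * lam * B ≤ 1`.
  have h := sum_cosh_norm_add_le hp hp1 (Y := fun i => lam • (Y i - m))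
    (by
      simp_rw [smul_comm _ lam]
      rw [← Finset.smul_sum]
      simp_rw [smul_sub]
      rw [Finset.sum_sub_distrib, ← Finset.sum_smul, hp1, one_smul, ← hm, sub_self, smul_zero])
    (fun i => by
      rw [norm_smul, Real.norm_of_nonneg hlam]
      have := (norm_sub_le (Y i) m).trans (add_le_add (hB i) hmB)
      nlinarith) (lam • x)
  simp_rw [← smul_add, norm_smul, Real.norm_of_nonneg hlam, mul_pow] at h
  simp_rw [add_sub_assoc]
  refine h.trans ?_
  rw [mul_comm]
  refine mul_le_mul_of_nonneg_right ?_ (Real.cosh_pos _).le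
  have : ∑ i, p i * (lam ^ 2 * ‖Y i - m‖ ^ 2) = lam ^ 2 * ∑ i, p i * ‖Y i - m‖ ^ 2 := by
    rw [Finset.mul_sum]; exact Finset.sum_congr rfl fun i _ => by ring
  rw [this]
  have := (sum_norm_sub_mean_sq_le hp1 Y).trans hσ
  gcongr

/-! ### The Frobenius norm -/

/-- The entries of a matrix as a vector of a Euclidean space, whose norm is the Frobenius norm. -/
noncomputable def toVec {a b : ℕ} :
    Matrix (Fin a) (Fin b) ℂ →ₗ[ℝ] EuclideanSpace ℂ (Fin a × Fin b) where
  toFun M := WithLp.toLp 2 fun q => M q.1 q.2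
  map_add' _ _ := rfl
  map_smul' _ _ := rfl

theorem norm_toVec {a b : ℕ} (M : Matrix (Fin a) (Fin b) ℂ) : ‖toVec M‖ = frobNorm M := by
  rw [EuclideanSpace.norm_eq, frobNorm, Fintype.sum_prod_type]
  rfl

theorem frobNorm_nonneg {a b : ℕ} (M : Matrix (Fin a) (Fin b) ℂ) : 0 ≤ frobNorm M :=
  Real.sqrt_nonneg _

theorem frobNorm_sq {a b : ℕ} (M : Matrix (Fin a) (Fin b) ℂ) :
    frobNorm M ^ 2 = ∑ i, ∑ j, ‖M i j‖ ^ 2 :=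
  Real.sq_sqrt (Finset.sum_nonneg fun _ _ => Finset.sum_nonneg fun _ _ => sq_nonneg _)

theorem rowNorm_sq {a b : ℕ} (M : Matrix (Fin a) (Fin b) ℂ) (i : Fin a) :
    rowNorm M i ^ 2 = ∑ j, ‖M i j‖ ^ 2 :=
  Real.sq_sqrt (Finset.sum_nonneg fun _ _ => sq_nonneg _)

theorem frobNorm_add_le {a b : ℕ} (M N : Matrix (Fin a) (Fin b) ℂ) :
    frobNorm (M + N) ≤ frobNorm M + frobNorm N := by
  simp only [← norm_toVec, map_add]
  exact norm_add_le _ _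

theorem frobNorm_sub_comm {a b : ℕ} (M N : Matrix (Fin a) (Fin b) ℂ) :
    frobNorm (M - N) = frobNorm (N - M) := by
  simp only [← norm_toVec, map_sub]
  exact norm_sub_rev _ _

theorem frobNorm_conjTranspose {a b : ℕ} (M : Matrix (Fin a) (Fin b) ℂ) :
    frobNorm Mᴴ = frobNorm M := by
  unfold frobNorm
  rw [Finset.sum_comm]
  simp [Matrix.conjTranspose_apply]

theorem frobNorm_sq_eq_trace {a b : ℕ} (M : Matrix (Fin a) (Fin b) ℂ) :
    ((frobNorm M ^ 2 : ℝ) : ℂ) = (Mᴴ * M).trace := by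
  rw [frobNorm_sq, Finset.sum_comm]
  simp only [Matrix.trace, Matrix.diag_apply, Matrix.mul_apply, Matrix.conjTranspose_apply]
  push_cast
  refine Finset.sum_congr rfl fun i _ => Finset.sum_congr rfl fun j _ => ?_
  rw [← Complex.conj_mul', Complex.star_def]

theorem frobNorm_eq_of_trace_eq {a b c d : ℕ} {M : Matrix (Fin a) (Fin b) ℂ}
    {N : Matrix (Fin c) (Fin d) ℂ} (h : (Mᴴ * M).trace = (Nᴴ * N).trace) :
    frobNorm M = frobNorm N := by
  rw [← frobNorm_sq_eq_trace, ← frobNorm_sq_eq_trace] at h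
  exact (sq_eq_sq₀ (frobNorm_nonneg _) (frobNorm_nonneg _)).1 (by exact_mod_cast h)

theorem frobNorm_isometry_mul {a b c : ℕ} {U : Matrix (Fin a) (Fin b) ℂ} (hU : Uᴴ * U = 1)
    (M : Matrix (Fin b) (Fin c) ℂ) : frobNorm (U * M) = frobNorm M := by
  apply frobNorm_eq_of_trace_eq
  rw [Matrix.conjTranspose_mul, Matrix.mul_assoc, ← Matrix.mul_assoc Uᴴ, hU, Matrix.one_mul]

theorem frobNorm_mul_isometry {a b c : ℕ} {U : Matrix (Fin b) (Fin c) ℂ} (hU : U * Uᴴ = 1)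
    (M : Matrix (Fin a) (Fin b) ℂ) : frobNorm (M * U) = frobNorm M := by
  rw [← frobNorm_conjTranspose, Matrix.conjTranspose_mul, frobNorm_isometry_mul (by simpa using hU),
    frobNorm_conjTranspose]

theorem frobNorm_of_isometry {n k : ℕ} {W : Matrix (Fin n) (Fin k) ℂ} (hW : Wᴴ * W = 1) :
    frobNorm W = √k := by
  have h := frobNorm_sq_eq_trace W
  rw [hW, Matrix.trace_one, Fintype.card_fin] at h
  rw [← Real.sqrt_sq (frobNorm_nonneg W)]
  congr 1
  exact_mod_cast h

theorem norm_le_frobNorm {a b : ℕ} (M : Matrix (Fin a) (Fin b) ℂ) : ‖M‖ ≤ frobNorm M := by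
  rw [Matrix.l2_opNorm_def]
  refine ContinuousLinearMap.opNorm_le_bound _ (frobNorm_nonneg _) fun x => ?_
  refine le_of_sq_le_sq ?_ (mul_nonneg (frobNorm_nonneg _) (norm_nonneg _))
  rw [mul_pow, frobNorm_sq, EuclideanSpace.norm_sq_eq, EuclideanSpace.norm_sq_eq, Finset.sum_mul]
  refine Finset.sum_le_sum fun i _ => ?_
  have h1 : ‖∑ j, M i j * x j‖ ≤ ∑ j, ‖M i j‖ * ‖x j‖ :=
    (norm_sum_le _ _).trans_eq (Finset.sum_congr rfl fun j _ => norm_mul _ _)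
  calc _ = ‖∑ j, M i j * x j‖ ^ 2 := rfl
    _ ≤ (∑ j, ‖M i j‖ * ‖x j‖) ^ 2 := by gcongr
    _ ≤ _ := Finset.sum_mul_sq_le_sq_mul_sq _ _ _

theorem norm_le_one_of_isometry {n k : ℕ} {W : Matrix (Fin n) (Fin k) ℂ} (hW : Wᴴ * W = 1) :
    ‖W‖ ≤ 1 := by
  have h := Matrix.l2_opNorm_conjTranspose_mul_self W
  rw [hW] at h
  have h1 : ‖(1 : Matrix (Fin k) (Fin k) ℂ)‖ ≤ 1 := by
    rw [← Matrix.diagonal_one, Matrix.l2_opNorm_diagonal]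
    exact (pi_norm_le_iff_of_nonneg zero_le_one).2 fun i => by simp
  nlinarith [norm_nonneg W]

/-- After diagonalisation this is a sum of squared eigenvalues: each is at most 1, and at most `r`
are nonzero. -/
theorem frobNorm_sq_le_of_rank_le {n r : ℕ} {A : Matrix (Fin n) (Fin n) ℂ} (hA : A.IsHermitian)
    (h1 : ‖A‖ ≤ 1) (hr : A.rank ≤ r) : frobNorm A ^ 2 ≤ r := by
  set U : Matrix (Fin n) (Fin n) ℂ := (hA.eigenvectorUnitary : Matrix (Fin n) (Fin n) ℂ) with hU
  have hU1 : Uᴴ * U = 1 := Unitary.coe_star_mul_self hA.eigenvectorUnitary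
  have hU2 : U * Uᴴ = 1 := Unitary.coe_mul_star_self hA.eigenvectorUnitary
  set D : Matrix (Fin n) (Fin n) ℂ := Matrix.diagonal (fun i => (hA.eigenvalues i : ℂ)) with hD
  have hspec : A = U * D * Uᴴ := hA.spectral_theorem
  have hDA : D = Uᴴ * A * U := by
    rw [hspec]
    simp only [Matrix.mul_assoc, hU1, Matrix.mul_one]
    rw [← Matrix.mul_assoc, hU1, Matrix.one_mul]
  have hnorm : ‖D‖ ≤ 1 := by
    rw [hDA]
    have hu := norm_le_one_of_isometry hU1
    have hu' : ‖Uᴴ‖ ≤ 1 := by rwa [Matrix.l2_opNorm_conjTranspose]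
    calc ‖Uᴴ * A * U‖ ≤ ‖Uᴴ‖ * ‖A‖ * ‖U‖ :=
          (Matrix.l2_opNorm_mul _ _).trans
            (mul_le_mul_of_nonneg_right (Matrix.l2_opNorm_mul _ _) (norm_nonneg _))
      _ ≤ 1 * 1 * 1 := by gcongr
      _ = 1 := by norm_num
  have hfrob : frobNorm A = frobNorm D := by
    conv_lhs => rw [hspec]
    rw [frobNorm_mul_isometry (by simpa using hU1), frobNorm_isometry_mul hU1]
  rw [hD, Matrix.l2_opNorm_diagonal, pi_norm_le_iff_of_nonneg zero_le_one] at hnorm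
  have hsum : frobNorm D ^ 2 = ∑ i, hA.eigenvalues i ^ 2 := by
    rw [frobNorm_sq]
    refine Finset.sum_congr rfl fun i _ => ?_
    rw [Finset.sum_eq_single i]
    · simp [hD]
    · intro j _ hj; simp [hD, Matrix.diagonal_apply_ne _ hj.symm]
    · simp
  rw [hfrob, hsum]
  have hle : ∀ i, hA.eigenvalues i ^ 2 ≤ if hA.eigenvalues i ≠ 0 then 1 else 0 := by
    intro i
    have hi := hnorm i
    simp only [Complex.norm_real, Real.norm_eq_abs] at hi
    split_ifs with h
    · exact (sq_le_one_iff_abs_le_one _).2 hi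
    · rw [not_not.1 h]; norm_num
  refine (Finset.sum_le_sum fun i _ => hle i).trans ?_
  rw [Finset.sum_boole, ← Fintype.card_subtype, ← hA.rank_eq_card_non_zero_eigs]
  exact_mod_cast hr

/-! ### Near isometries -/

section NearIsometry

variable {n k : ℕ} {V : Matrix (Fin n) (Fin k) ℂ} {κ : ℝ}

theorem NearIsometry.norm_le (hV : NearIsometry V κ) : ‖V‖ ≤ 1 + κ := by
  obtain ⟨W, hW, -, hκ⟩ := hV
  have h : V = W - (W - V) := by abel
  calc ‖V‖ ≤ ‖W‖ + ‖W - V‖ := by conv_lhs => rw [h]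
                                 exact norm_sub_le _ _
    _ ≤ 1 + κ := add_le_add (norm_le_one_of_isometry hW) ((norm_le_frobNorm _).trans hκ)

theorem NearIsometry.frobNorm_le (hV : NearIsometry V κ) : frobNorm V ≤ √k + κ := by
  obtain ⟨W, hW, -, hκ⟩ := hV
  have h : V = W + (V - W) := by abel
  calc frobNorm V ≤ frobNorm W + frobNorm (V - W) := by conv_lhs => rw [h]
                                                        exact frobNorm_add_le _ _
    _ ≤ √k + κ := add_le_add (frobNorm_of_isometry hW).le (by rwa [frobNorm_sub_comm])

theorem NearIsometry.mul_unitary (hV : NearIsometry V κ) {U : Matrix (Fin k) (Fin k) ℂ}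
    (hU : U ∈ Matrix.unitaryGroup (Fin k) ℂ) : NearIsometry (V * U) κ := by
  obtain ⟨W, hW, hrange, hκ⟩ := hV
  have hU1 : Uᴴ * U = 1 := Matrix.mem_unitaryGroup_iff'.1 hU
  have hU2 : U * Uᴴ = 1 := Matrix.mem_unitaryGroup_iff.1 hU
  have hsurj : LinearMap.range U.mulVecLin = ⊤ := by
    rw [LinearMap.range_eq_top]
    intro x
    refine ⟨Uᴴ *ᵥ x, ?_⟩
    simp [Matrix.mulVec_mulVec, hU2]
  refine ⟨W * U, ?_, ?_, ?_⟩
  · rw [Matrix.conjTranspose_mul, Matrix.mul_assoc, ← Matrix.mul_assoc Wᴴ, hW, Matrix.one_mul, hU1]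
  · rw [Matrix.mulVecLin_mul, Matrix.mulVecLin_mul, LinearMap.range_comp, LinearMap.range_comp,
      hsurj, Submodule.map_top, Submodule.map_top, hrange]
  · rwa [← Matrix.sub_mul, frobNorm_mul_isometry hU2]

/-- Split `V B Vᴴ - A` into `V (B - Vᴴ A V) Vᴴ`, which costs a factor `‖V‖²`, and the compression
error `V Vᴴ A V Vᴴ - A`. -/
theorem norm_compress_sub_le (hV : NearIsometry V κ) {A : Matrix (Fin n) (Fin n) ℂ}
    {B : Matrix (Fin k) (Fin k) ℂ} {η β : ℝ} (hB : frobNorm (Vᴴ * A * V - B) ≤ η)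
    (hA : frobNorm (V * Vᴴ * A * V * Vᴴ - A) ≤ β) :
    ‖V * B * Vᴴ - A‖ ≤ (1 + κ) ^ 2 * η + β := by
  have hdecomp : V * B * Vᴴ - A = V * (B - Vᴴ * A * V) * Vᴴ + (V * Vᴴ * A * V * Vᴴ - A) := by
    simp only [Matrix.mul_sub, Matrix.sub_mul, Matrix.mul_assoc]
    abel
  have hVn := hV.norm_le
  have h1 : ‖B - Vᴴ * A * V‖ ≤ η := (norm_le_frobNorm _).trans (by rwa [frobNorm_sub_comm])
  rw [hdecomp]
  refine (norm_add_le _ _).trans (add_le_add ?_ ((norm_le_frobNorm _).trans hA))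
  calc ‖V * (B - Vᴴ * A * V) * Vᴴ‖ ≤ ‖V‖ * ‖B - Vᴴ * A * V‖ * ‖Vᴴ‖ :=
        (Matrix.l2_opNorm_mul _ _).trans
          (mul_le_mul_of_nonneg_right (Matrix.l2_opNorm_mul _ _) (norm_nonneg _))
    _ = ‖V‖ ^ 2 * ‖B - Vᴴ * A * V‖ := by rw [Matrix.l2_opNorm_conjTranspose]; ring
    _ ≤ (1 + κ) ^ 2 * η := by gcongr

end NearIsometry

/-! ### The clipped estimator of `Vᴴ * A * V` from one sampled entry of `A` -/

section Estimator

variable {n k : ℕ}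

/-- The reciprocal of the probability of sampling an entry, times the entry. -/
noncomputable def weight (A : Matrix (Fin n) (Fin n) ℂ) (s t : Fin n) : ℂ :=
  (frobNorm A : ℂ) * frobNorm A / star (A s t)

/-- The unbiased estimator of `Vᴴ * A * V` given by the entry `(s, t)`. -/
noncomputable def rawEst (A : Matrix (Fin n) (Fin n) ℂ) (V : Matrix (Fin n) (Fin k) ℂ)
    (s t : Fin n) : Matrix (Fin k) (Fin k) ℂ :=
  Matrix.of fun i j => weight A s t * (star (V s i) * V t j)

/-- The square of the Frobenius norm of the unbiased estimator. -/
noncomputable def estSq (A : Matrix (Fin n) (Fin n) ℂ) (V : Matrix (Fin n) (Fin k) ℂ)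
    (s t : Fin n) : ℝ :=
  ‖weight A s t‖ ^ 2 * rowNorm V s ^ 2 * rowNorm V t ^ 2

/-- The Hermitian part of the unbiased estimator. -/
noncomputable def symEst (A : Matrix (Fin n) (Fin n) ℂ) (V : Matrix (Fin n) (Fin k) ℂ)
    (s t : Fin n) : Matrix (Fin k) (Fin k) ℂ :=
  (1 / 2 : ℝ) • (rawEst A V s t + (rawEst A V s t)ᴴ)

open Classical in
/-- The Hermitian part of the unbiased estimator, replaced by zero if this is too large. -/
noncomputable def clipEst (A : Matrix (Fin n) (Fin n) ℂ) (V : Matrix (Fin n) (Fin k) ℂ) (b : ℝ)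
    (s t : Fin n) : Matrix (Fin k) (Fin k) ℂ :=
  if estSq A V s t ≤ b then symEst A V s t else 0

/-- The mean of the clipped estimator. -/
noncomputable def clipMean (A : Matrix (Fin n) (Fin n) ℂ) (V : Matrix (Fin n) (Fin k) ℂ)
    (b : ℝ) : Matrix (Fin k) (Fin k) ℂ :=
  ∑ q : Fin n × Fin n, (rowProb A q.1 * entryProb A q.1 q.2) • clipEst A V b q.1 q.2

variable {A : Matrix (Fin n) (Fin n) ℂ} {V : Matrix (Fin n) (Fin k) ℂ}

/-- The row norm cancels, so sampling in two stages gives the squared-entry distribution. On a zero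
row both sides vanish under the division convention. -/
theorem rowProb_mul_entryProb (A : Matrix (Fin n) (Fin n) ℂ) (s t : Fin n) :
    rowProb A s * entryProb A s t = ‖A s t‖ ^ 2 / frobNorm A ^ 2 := by
  rw [rowProb, entryProb]
  by_cases h : rowNorm A s ^ 2 = 0
  · have h0 : ‖A s t‖ ^ 2 = 0 := by
      rw [rowNorm_sq, Finset.sum_eq_zero_iff_of_nonneg fun _ _ => sq_nonneg _] at h
      exact h t (Finset.mem_univ t)
    rw [h, h0]; simp
  · have h' : rowNorm A s ≠ 0 := fun h0 => h (by simp [h0])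
    field_simp

theorem sum_rowProb_mul_entryProb (hA : frobNorm A ≠ 0) :
    ∑ q : Fin n × Fin n, rowProb A q.1 * entryProb A q.1 q.2 = 1 := by
  simp_rw [rowProb_mul_entryProb]
  rw [← Finset.sum_div, Fintype.sum_prod_type]
  dsimp only
  rw [← frobNorm_sq, div_self (pow_ne_zero 2 hA)]

theorem frobNorm_rawEst_sq (s t : Fin n) : frobNorm (rawEst A V s t) ^ 2 = estSq A V s t := by
  rw [frobNorm_sq, estSq, mul_assoc, rowNorm_sq, rowNorm_sq, Finset.sum_mul_sum, Finset.mul_sum]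
  refine Finset.sum_congr rfl fun i _ => ?_
  rw [Finset.mul_sum]
  refine Finset.sum_congr rfl fun j _ => ?_
  simp only [rawEst, Matrix.of_apply, norm_mul, norm_star]
  ring

theorem estSq_nonneg (A : Matrix (Fin n) (Fin n) ℂ) (V : Matrix (Fin n) (Fin k) ℂ)
    (s t : Fin n) : 0 ≤ estSq A V s t := by
  unfold estSq; positivity

theorem frobNorm_symEst_le (s t : Fin n) : frobNorm (symEst A V s t) ≤ √(estSq A V s t) := by
  have h : frobNorm (symEst A V s t) ≤ (1 / 2) * (frobNorm (rawEst A V s t) +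
      frobNorm (rawEst A V s t)) := by
    conv_rhs => rhs; rhs; rw [← frobNorm_conjTranspose]
    refine le_trans ?_ (mul_le_mul_of_nonneg_left (frobNorm_add_le _ _) (by norm_num))
    rw [← norm_toVec, symEst, map_smul, norm_smul, norm_toVec]
    norm_num
  rw [← frobNorm_rawEst_sq, Real.sqrt_sq (frobNorm_nonneg _)]
  linarith

theorem frobNorm_zero {a b : ℕ} : frobNorm (0 : Matrix (Fin a) (Fin b) ℂ) = 0 := by
  rw [← norm_toVec, map_zero, norm_zero]

theorem frobNorm_clipEst_le {B : ℝ} (hB : 0 ≤ B) (s t : Fin n) :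
    frobNorm (clipEst A V (B ^ 2) s t) ≤ B := by
  rw [clipEst]
  split_ifs with h
  · exact (frobNorm_symEst_le s t).trans (Real.sqrt_le_iff.2 ⟨hB, h⟩)
  · rwa [frobNorm_zero]

theorem frobNorm_clipEst_sq_le (b : ℝ) (s t : Fin n) :
    frobNorm (clipEst A V b s t) ^ 2 ≤ estSq A V s t := by
  rw [clipEst]
  split_ifs with h
  · exact (pow_le_pow_left₀ (frobNorm_nonneg _) (frobNorm_symEst_le s t) 2).trans_eq
      (Real.sq_sqrt (estSq_nonneg _ _ _ _))
  · simpa [frobNorm_zero] using estSq_nonneg A V s t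

theorem isHermitian_clipEst (b : ℝ) (s t : Fin n) : (clipEst A V b s t).IsHermitian := by
  rw [clipEst]
  split_ifs with h
  · rw [Matrix.IsHermitian, symEst, Matrix.conjTranspose_smul, Matrix.conjTranspose_add,
      Matrix.conjTranspose_conjTranspose, add_comm, star_trivial]
  · exact Matrix.isHermitian_zero

/-- Probability times `‖weight‖²` is exactly `‖A‖_F²` wherever the entry is nonzero, and then the
sum factors through the row norms of `V`. Only an inequality holds in general, since zero entries
contribute nothing on the left. -/
theorem sum_prob_mul_estSq_le :
    ∑ q : Fin n × Fin n, (rowProb A q.1 * entryProb A q.1 q.2) * estSq A V q.1 q.2 ≤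
      frobNorm A ^ 2 * (frobNorm V ^ 2) ^ 2 := by
  have h : ∀ q : Fin n × Fin n, (rowProb A q.1 * entryProb A q.1 q.2) * estSq A V q.1 q.2 ≤
      frobNorm A ^ 2 * (rowNorm V q.1 ^ 2 * rowNorm V q.2 ^ 2) := by
    rintro ⟨s, t⟩
    rw [rowProb_mul_entryProb]
    by_cases h0 : A s t = 0
    · simp only [h0, norm_zero]
      rw [zero_pow two_ne_zero, zero_div, zero_mul]; positivity
    have hn : ‖A s t‖ ≠ 0 := norm_ne_zero_iff.2 h0
    by_cases hF : frobNorm A = 0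
    · simp [hF]
    refine le_of_eq ?_
    simp only [estSq, weight, norm_div, norm_mul, norm_star, Complex.norm_real, Real.norm_eq_abs,
      abs_of_nonneg (frobNorm_nonneg A)]
    field_simp
  refine (Finset.sum_le_sum fun q _ => h q).trans_eq ?_
  rw [← Finset.mul_sum, Fintype.sum_prod_type]
  dsimp only
  rw [← Finset.sum_mul_sum, ← sq]
  congr 2
  rw [frobNorm_sq]
  exact Finset.sum_congr rfl fun i _ => rowNorm_sq V i

/-- Probability times `weight` is `A s t`, also for a zero entry, where both are zero. The adjoint
estimator has mean `(Vᴴ A V)ᴴ = Vᴴ A V`, so taking Hermitian parts keeps the mean. -/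
theorem sum_prob_smul_symEst (hA : A.IsHermitian) :
    ∑ q : Fin n × Fin n, (rowProb A q.1 * entryProb A q.1 q.2) • symEst A V q.1 q.2 =
      Vᴴ * A * V := by
  have hraw : ∑ q : Fin n × Fin n, (rowProb A q.1 * entryProb A q.1 q.2) • rawEst A V q.1 q.2 =
      Vᴴ * A * V := by
    ext i j
    rw [Matrix.sum_apply, Matrix.mul_apply]
    simp only [Matrix.mul_apply, Finset.sum_mul, Matrix.conjTranspose_apply]
    rw [Fintype.sum_prod_type, Finset.sum_comm]
    refine Finset.sum_congr rfl fun t _ => Finset.sum_congr rfl fun s _ => ?_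
    rw [rowProb_mul_entryProb, Matrix.smul_apply, rawEst, Matrix.of_apply, weight]
    by_cases h0 : A s t = 0
    · simp [h0]
    have hF : frobNorm A ≠ 0 := by
      intro hF
      have h := frobNorm_sq A
      rw [hF, zero_pow two_ne_zero, eq_comm, Finset.sum_eq_zero_iff_of_nonneg
        fun _ _ => Finset.sum_nonneg fun _ _ => sq_nonneg _] at h
      have h := h s (Finset.mem_univ s)
      rw [Finset.sum_eq_zero_iff_of_nonneg fun _ _ => sq_nonneg _] at h
      exact h0 (by simpa using h t (Finset.mem_univ t))
    have hF' : (frobNorm A : ℂ) ≠ 0 := by exact_mod_cast hF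
    have h1 : (star (A s t)) ≠ 0 := star_ne_zero.2 h0
    have h2 : ((‖A s t‖ ^ 2 / frobNorm A ^ 2 : ℝ) : ℂ) =
        A s t * star (A s t) / (frobNorm A : ℂ) ^ 2 := by
      push_cast
      rw [Complex.star_def, Complex.mul_conj']
    rw [Complex.real_smul, h2]
    field_simp
  have hconj : ∑ q : Fin n × Fin n,
      (rowProb A q.1 * entryProb A q.1 q.2) • (rawEst A V q.1 q.2)ᴴ = Vᴴ * A * V := by
    have h := congrArg Matrix.conjTranspose hraw
    rw [Matrix.conjTranspose_sum] at h
    simp only [Matrix.conjTranspose_smul, star_trivial, Matrix.conjTranspose_mul,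
      Matrix.conjTranspose_conjTranspose, hA.eq] at h
    rw [h, Matrix.mul_assoc]
  simp_rw [symEst, smul_comm _ (1 / 2 : ℝ), smul_add, ← smul_add (1 / 2 : ℝ)]
  rw [← Finset.smul_sum, Finset.sum_add_distrib, hraw, hconj, ← two_smul ℝ, smul_smul]
  norm_num

theorem frobNorm_sum_smul_le {ι : Type*} (q : Finset ι) {p : ι → ℝ} (hp : ∀ i, 0 ≤ p i) {a b : ℕ}
    (M : ι → Matrix (Fin a) (Fin b) ℂ) :
    frobNorm (∑ i ∈ q, p i • M i) ≤ ∑ i ∈ q, p i * frobNorm (M i) := by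
  simp only [← norm_toVec, map_sum, map_smul]
  refine (norm_sum_le _ _).trans_eq (Finset.sum_congr rfl fun i _ => ?_)
  rw [norm_smul, Real.norm_of_nonneg (hp i)]

/-- Only the discarded estimates contribute. They have norm `x ≥ B`, so `x ≤ x² / B`, and the second
moment bounds the sum. -/
theorem frobNorm_sub_clipMean_le (hA : A.IsHermitian) {B σ2 : ℝ} (hB : 0 < B)
    (hσ : frobNorm A ^ 2 * (frobNorm V ^ 2) ^ 2 ≤ σ2) :
    frobNorm (Vᴴ * A * V - clipMean A V (B ^ 2)) ≤ σ2 / B := by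
  rw [← sum_prob_smul_symEst hA, clipMean, ← Finset.sum_sub_distrib]
  simp_rw [← smul_sub]
  have hp : ∀ q : Fin n × Fin n, 0 ≤ rowProb A q.1 * entryProb A q.1 q.2 := fun q =>
    mul_nonneg (Triple.rowProb_nonneg _ _) (Triple.entryProb_nonneg _ _ _)
  refine (frobNorm_sum_smul_le _ hp _).trans ?_
  rw [le_div_iff₀ hB, Finset.sum_mul]
  refine le_trans (Finset.sum_le_sum fun q _ => ?_) (sum_prob_mul_estSq_le.trans hσ)
  rw [mul_assoc]
  refine mul_le_mul_of_nonneg_left ?_ (hp q)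
  rw [clipEst]
  split_ifs with h
  · rw [sub_self, frobNorm_zero, zero_mul]; exact estSq_nonneg _ _ _ _
  · rw [sub_zero]
    have h1 := frobNorm_symEst_le (A := A) (V := V) q.1 q.2
    have h2 : B ≤ √(estSq A V q.1 q.2) := Real.le_sqrt_of_sq_le (not_le.1 h).le
    calc _ ≤ √(estSq A V q.1 q.2) * √(estSq A V q.1 q.2) := by gcongr
      _ = _ := Real.mul_self_sqrt (estSq_nonneg _ _ _ _)

theorem sum_cosh_clipEst_le (hF : frobNorm A ≠ 0) {B σ2 lam : ℝ} (hB : 0 ≤ B)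
    (hσ : frobNorm A ^ 2 * (frobNorm V ^ 2) ^ 2 ≤ σ2) (hlam : 0 ≤ lam) (hlB : 2 * lam * B ≤ 1)
    (M : Matrix (Fin k) (Fin k) ℂ) :
    ∑ q : Fin n × Fin n, (rowProb A q.1 * entryProb A q.1 q.2) *
      Real.cosh (lam * frobNorm (M + clipEst A V (B ^ 2) q.1 q.2 - clipMean A V (B ^ 2))) ≤
      (1 + lam ^ 2 * σ2) * Real.cosh (lam * frobNorm M) := by
  have hp : ∀ q : Fin n × Fin n, 0 ≤ rowProb A q.1 * entryProb A q.1 q.2 := fun q =>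
    mul_nonneg (Triple.rowProb_nonneg _ _) (Triple.entryProb_nonneg _ _ _)
  have h := sum_cosh_norm_add_sub_mean_le hp (sum_rowProb_mul_entryProb hF) (σ2 := σ2)
    (Y := fun q => toVec (clipEst A V (B ^ 2) q.1 q.2)) hlam
    (fun q => by rw [norm_toVec]; exact frobNorm_clipEst_le hB _ _) hlB
    (by
      refine le_trans (Finset.sum_le_sum fun q _ => ?_) (sum_prob_mul_estSq_le.trans hσ)
      rw [norm_toVec]
      exact mul_le_mul_of_nonneg_left (frobNorm_clipEst_sq_le _ _ _) (hp q)) (toVec M)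
  rw [clipMean]
  simpa only [← map_smul, ← map_sum, ← map_add, ← map_sub, norm_toVec] using h

end Estimator

/-! ### The program -/

namespace Prog

/-- Load a constant. -/
abbrev iconst (d v : ℕ) : Prog := .instr (.const d v)
/-- Integer addition. -/
abbrev iadd (d a b : ℕ) : Prog := .instr (.int .add d a b)
/-- Addition of numbers. -/
abbrev nadd (d a b : ℕ) : Prog := .instr (.num .add d a b)
/-- Subtraction of numbers. -/
abbrev nsub (d a b : ℕ) : Prog := .instr (.num .sub d a b)
/-- Multiplication of numbers. -/
abbrev nmul (d a b : ℕ) : Prog := .instr (.num .mul d a b)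
/-- Division of numbers. -/
abbrev ndiv (d a b : ℕ) : Prog := .instr (.num .div d a b)
/-- Complex conjugation. -/
abbrev nconj (d a : ℕ) : Prog := .instr (.conj d a)
/-- Conversion of an integer to a number. -/
abbrev ncast (d a : ℕ) : Prog := .instr (.cast d a)

/-- Sequential composition of a list of programs, followed by one more. -/
abbrev block (l : List Prog) (P : Prog) : Prog := l.foldr .seq P

/-- One round of the computation of the squared norms of two rows of `V`. -/
def rowNormsBody : Prog :=
  block [.instr (.entryV 30 11 8), nconj 31 30, nmul 30 30 31, nadd 28 28 30,
    .instr (.entryV 30 12 8), nconj 31 30, nmul 30 30 31, nadd 29 29 30] (iadd 8 8 5)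

/-- Compute the squared norms of the rows of `V` with indices in registers `11`, `12`. -/
def rowNorms : Prog :=
  block [nsub 28 28 28, nsub 29 29 29, iconst 8 0] (.loop (.intLt 8 2) rowNormsBody)

/-- Add the current estimate to one entry of the accumulator. -/
def addEntry : Prog :=
  block [.instr (.entryV 30 11 8), nconj 30 30, .instr (.entryV 31 12 9), nmul 30 30 31,
    nmul 30 30 27, nadd 13 13 30,
    .instr (.entryV 30 12 8), nconj 30 30, .instr (.entryV 31 11 9), nmul 30 30 31,
    nconj 31 27, nmul 30 30 31, nadd 13 13 30, iadd 13 13 5] (iadd 9 9 5)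

/-- Add the current estimate to one row of the accumulator. -/
def addRow : Prog :=
  block [iconst 9 0, .loop (.intLt 9 2) addEntry] (iadd 8 8 5)

/-- Add the current estimate to the accumulator. -/
def addEst : Prog :=
  block [ndiv 27 27 26, iconst 8 0, iadd 13 0 4] (.loop (.intLt 8 2) addRow)

/-- Process one sampled entry. -/
def useEntry : Prog :=
  -- Number register 7 turns from `‖A‖_F` into `‖A‖_F² / conj A_ab`. The clipping test compares
  -- squares, so no square root is needed, and only two rows of `V` are read for it.
  block [nmul 27 27 27, .instr (.entry 30 6 11 12), nconj 30 30, ndiv 27 27 30, rowNorms,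
    nconj 30 27, nmul 30 30 27, nmul 30 30 28, nmul 30 30 29]
    (.cond (.numLe 30 24) addEst (iconst 14 0))

/-- Sample an entry of the matrix `A ℓ`, with `ℓ` in register `6`, unless `A ℓ = 0`, and process
it. -/
def sample : Prog :=
  .seq (.instr (.frob 27 6))
    (.cond (.numLe 27 32) (iconst 14 0)
      (block [.instr (.sampleRow 11 6), .instr (.sampleEntry 12 6 11)] useEntry))

/-- Process all samples from the matrix `A ℓ`, with `ℓ` in register `6`. -/
def sampleMatrix : Prog :=
  block [iconst 7 0, .loop (.intLt 7 10) (.seq sample (iadd 7 7 5))] (iadd 6 6 5)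

/-- Put `64 * r ^ 3 * τ / ε_s ^ 2` into the number register `2` and `64 * r ^ 6 * τ ^ 2 / ε_s ^ 2`
into the number register `4`, for `ε_s = ε / (400 * r ^ 2)`. -/
def parameters : Prog :=
  block [iconst 14 400, ncast 22 14, ncast 23 3, nmul 22 22 23, nmul 22 22 23, ndiv 22 22 20,
    nmul 22 22 22, nmul 22 22 23, nmul 22 22 23, nmul 22 22 23,
    nmul 24 22 23, nmul 24 24 23, nmul 24 24 23, ncast 23 1, nmul 22 22 23, nmul 24 24 23,
    nmul 24 24 23, iconst 14 64, ncast 23 14, nmul 22 22 23, nmul 24 24 23, ncast 23 4,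
    iconst 14 2] (ncast 25 14)

/-- Put the addresses of the number registers used into integer registers. -/
def addresses : Prog :=
  -- The accumulator starts at 16, above the named number registers. Integer register 0 is where
  -- `State.result` looks for the address; overwriting `n` there is harmless, as the program never
  -- reads it.
  block [iconst 0 16, iconst 5 1, iconst 21 1, iconst 22 2, iconst 23 3, iconst 24 4, iconst 25 5,
    iconst 26 6, iconst 27 7, iconst 28 8, iconst 29 9, iconst 30 10, iconst 31 11] (iconst 32 12)

/-- Compute the number of samples. -/
def sampleCount : Prog :=
  -- Doubling `δ` until it exceeds 2 replaces a logarithm. Each doubling adds `64r³τ/ε_s²` to a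
  -- running sum, which the second loop then exceeds by counting. The final factor 2 belongs to the
  -- Hermitian part.
  block [.loop (.numLe 21 25) (.seq (nadd 23 23 22) (nadd 21 21 21)),
    .loop (.numLe 26 23) (.seq (iadd 10 10 5) (ncast 26 10))] (nmul 26 26 25)

/-- The program: average clipped estimators of `Vᴴ * A ℓ * V` and sum over `ℓ`. -/
def approximate : Prog :=
  block [addresses, parameters, sampleCount] (.loop (.intLt 6 1) sampleMatrix)

end Prog

/-! ### Verification of the program: registers, expectation bound and running time. -/

namespace Triple

variable {n τ k : ℕ} {O : Access n τ k} {fuel : ℕ} {s : State} {v : ℝ} {Q : State → ℝ → Prop}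

theorem entryV_of {d i j : ℕ} (a : Fin n) (b : Fin k) (ha : s.x i = a) (hb : s.x j = b)
    (h : Q ((s.tick O.p).setNum d (O.V a b)) v) :
    Triple O fuel (.instr (.entryV d i j)) s v Q := by
  refine entryV ⟨ha ▸ a.2, hb ▸ b.2⟩ ?_
  convert h using 4

theorem entry_of {d l i j : ℕ} (c : Fin τ) (a b : Fin n) (hc : s.x l = c) (ha : s.x i = a)
    (hb : s.x j = b) (h : Q ((s.tick (1 + Real.log n)).setNum d (O.A c a b)) v) :
    Triple O fuel (.instr (.entry d l i j)) s v Q := by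
  refine entry ⟨hc ▸ c.2, ha ▸ a.2, hb ▸ b.2⟩ ?_
  convert h using 5

theorem frob_of {d l : ℕ} (c : Fin τ) (hc : s.x l = c)
    (h : Q ((s.tick (1 + Real.log n)).setNum d (frobNorm (O.A c) : ℝ)) v) :
    Triple O fuel (.instr (.frob d l)) s v Q := by
  refine frob (hc ▸ c.2) ?_
  convert h using 6

theorem sampleRow_of {d l : ℕ} (c : Fin τ) (hc : s.x l = c) (w : Fin n → ℝ)
    (hv : v ≤ ∑ i, rowProb (O.A c) i * w i)
    (h : ∀ i, rowProb (O.A c) i ≠ 0 → Q ((s.tick (1 + Real.log n)).setInt d i) (w i)) :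
    Triple O fuel (.instr (.sampleRow d l)) s v Q := by
  have hl : s.x l < τ := hc ▸ c.2
  obtain rfl : c = ⟨s.x l, hl⟩ := Fin.ext hc.symm
  exact sampleRow hl w hv h

theorem sampleEntry_of {d l r : ℕ} (c : Fin τ) (a : Fin n) (hc : s.x l = c) (ha : s.x r = a)
    (w : Fin n → ℝ) (hv : v ≤ ∑ j, entryProb (O.A c) a j * w j)
    (h : ∀ j, entryProb (O.A c) a j ≠ 0 → Q ((s.tick (1 + Real.log n)).setInt d j) (w j)) :
    Triple O fuel (.instr (.sampleEntry d l r)) s v Q := by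
  have hl : s.x l < τ := hc ▸ c.2
  have hr : s.x r < n := ha ▸ a.2
  obtain rfl : c = ⟨s.x l, hl⟩ := Fin.ext hc.symm
  obtain rfl : a = ⟨s.x r, hr⟩ := Fin.ext ha.symm
  exact sampleEntry ⟨hl, hr⟩ w hv h

end Triple

/-- The integer registers that hold addresses of number registers. -/
structure Addressed (s : State) : Prop where
  x0 : s.x 0 = 16
  x4 : s.x 4 = 0
  x5 : s.x 5 = 1
  x20 : s.x 20 = 0
  x21 : s.x 21 = 1
  x22 : s.x 22 = 2
  x23 : s.x 23 = 3
  x24 : s.x 24 = 4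
  x25 : s.x 25 = 5
  x26 : s.x 26 = 6
  x27 : s.x 27 = 7
  x28 : s.x 28 = 8
  x29 : s.x 29 = 9
  x30 : s.x 30 = 10
  x31 : s.x 31 = 11
  x32 : s.x 32 = 12

theorem Addressed.of_eq {s s' : State} (h : Addressed s) (h0 : s'.x 0 = s.x 0)
    (h4 : s'.x 4 = s.x 4) (h5 : s'.x 5 = s.x 5) (h20 : ∀ a, 20 ≤ a → s'.x a = s.x a) :
    Addressed s' := by
  constructor <;> first
    | rw [h0, h.x0] | rw [h4, h.x4] | rw [h5, h.x5]
    | (rw [h20 _ (by norm_num)]; first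
        | exact h.x20 | exact h.x21 | exact h.x22 | exact h.x23 | exact h.x24 | exact h.x25
        | exact h.x26 | exact h.x27 | exact h.x28 | exact h.x29 | exact h.x30 | exact h.x31
        | exact h.x32)

variable {n τ k : ℕ} {O : Access n τ k} {fuel : ℕ} {s : State} {v : ℝ}

theorem triple_rowNormsBody (hs : Addressed s) (a b : Fin n) (j : Fin k) (ha : s.x 11 = a)
    (hb : s.x 12 = b) (hj : s.x 8 = j) :
    Triple O fuel .rowNormsBody s v fun s' v' => v' = v ∧
      s'.x 8 = j + 1 ∧ (∀ q, q ≠ 8 → s'.x q = s.x q) ∧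
      (∀ q, q ≠ 8 → q ≠ 9 → q ≠ 10 → q ≠ 11 → s'.c q = s.c q) ∧
      s'.c 8 = s.c 8 + O.V a j * star (O.V a j) ∧ s'.c 9 = s.c 9 + O.V b j * star (O.V b j) ∧
      s'.t = s.t + (7 + 2 * O.p) := by
  obtain ⟨x0, x4, x5, x20, x21, x22, x23, x24, x25, x26, x27, x28, x29, x30, x31, x32⟩ := hs
  refine .seq <| .entryV_of a j (by simpa) (by simpa) <| .seq <| .conj <| .seq <| .num <|
    .seq <| .num <| .seq <| .entryV_of b j ?_ ?_ <| .seq <| .conj <| .seq <| .num <|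
    .seq <| .num <| .int ?_
  · simp [State.setNum, State.tick, State.num, *]
  · simp [State.setNum, State.tick, State.num, *]
  · simp +contextual [State.setInt, State.setNum, State.tick, State.num, NumOp.eval, IntOp.eval, *]
    ring

theorem triple_rowNorms (hs : Addressed s) (hfuel : k < fuel) (a b : Fin n) (ha : s.x 11 = a)
    (hb : s.x 12 = b) (hk : s.x 2 = k) :
    Triple O fuel .rowNorms s v fun s' v' => v' = v ∧
      (∀ q, q ≠ 8 → s'.x q = s.x q) ∧
      (∀ q, q ≠ 8 → q ≠ 9 → q ≠ 10 → q ≠ 11 → s'.c q = s.c q) ∧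
      s'.c 8 = (rowNorm O.V a ^ 2 : ℝ) ∧ s'.c 9 = (rowNorm O.V b ^ 2 : ℝ) ∧
      s'.t = s.t + (4 + k * (8 + 2 * O.p)) := by
  have hx := hs
  obtain ⟨x0, x4, x5, x20, x21, x22, x23, x24, x25, x26, x27, x28, x29, x30, x31, x32⟩ := hs
  refine .seq <| .num <| .seq <| .num <| .seq <| .const ?_
  have hsum : ∀ c : Fin n, ∑ j : Fin k, O.V c j * star (O.V c j) = (rowNorm O.V c ^ 2 : ℝ) := by
    intro c
    rw [rowNorm_sq]
    push_cast
    exact Finset.sum_congr rfl fun j _ => by rw [Complex.star_def, Complex.mul_conj']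
  refine .loop (fun i s' v' => v' = v ∧ s'.x 8 = i ∧ (∀ q, q ≠ 8 → s'.x q = s.x q) ∧
      (∀ q, q ≠ 8 → q ≠ 9 → q ≠ 10 → q ≠ 11 → s'.c q = s.c q) ∧
      s'.c 8 = ∑ j : Fin k, (if (j : ℕ) < i then O.V a j * star (O.V a j) else 0) ∧
      s'.c 9 = ∑ j : Fin k, (if (j : ℕ) < i then O.V b j * star (O.V b j) else 0) ∧
      s'.t = s.t + (3 + i * (8 + 2 * O.p))) k hfuel ?_ ?_ ?_
  · simp +contextual [State.setInt, State.setNum, State.tick, State.num, NumOp.eval, *]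
    ring
  · rintro i s' v' hi ⟨rfl, h8, hX, hC, hc8, hc9, ht⟩
    refine ⟨by simp [Test.Holds, h8, hX, hk, hi], ?_⟩
    have hstep : ∀ c : Fin n, ∑ j : Fin k, (if (j : ℕ) < i + 1 then O.V c j * star (O.V c j) else 0)
        = ∑ j : Fin k, (if (j : ℕ) < i then O.V c j * star (O.V c j) else 0) +
          O.V c ⟨i, hi⟩ * star (O.V c ⟨i, hi⟩) := by
      intro c
      rw [← Finset.sum_add_sum_compl {⟨i, hi⟩}, ← Finset.sum_add_sum_compl {⟨i, hi⟩} (fun j : Fin k =>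
        if (j : ℕ) < i then O.V c j * star (O.V c j) else 0), Finset.sum_singleton,
        Finset.sum_singleton, if_pos (Nat.lt_succ_self i), if_neg (lt_irrefl i), zero_add, add_comm]
      congr 1
      refine Finset.sum_congr rfl fun j hj => ?_
      have : (j : ℕ) ≠ i := fun h => by simp [Fin.ext_iff, h] at hj
      exact if_congr (by omega) rfl rfl
    refine (triple_rowNormsBody (s := s'.tick 1) (hx.of_eq (hX _ (by simp)) (hX _ (by simp))
      (hX _ (by simp)) fun q hq => hX _ (by omega)) a b ⟨i, hi⟩ ((hX _ (by simp)).trans ha)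
      ((hX _ (by simp)).trans hb) h8).mono ?_
    rintro s'' v'' ⟨rfl, h8', hX', hC', hc8', hc9', ht'⟩
    refine ⟨rfl, h8', fun q hq => (hX' q hq).trans (hX q hq), fun q h1 h2 h3 h4 =>
      (hC' q h1 h2 h3 h4).trans (hC q h1 h2 h3 h4), ?_, ?_, ?_⟩
    · rw [hc8', hstep, ← hc8]; rfl
    · rw [hc9', hstep, ← hc9]; rfl
    · rw [ht', State.tick, ht]; push_cast; ring
  · rintro s' v' ⟨rfl, h8, hX, hC, hc8, hc9, ht⟩
    refine ⟨by simp [Test.Holds, h8, hX, hk], rfl, hX, hC, ?_, ?_, ?_⟩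
    · rw [← hsum]; exact hc8.trans (Finset.sum_congr rfl fun j _ => if_pos j.2)
    · rw [← hsum]; exact hc9.trans (Finset.sum_congr rfl fun j _ => if_pos j.2)
    · rw [State.tick, ht]; ring

/-- What the program adds to the entry `(i, j)` of the accumulator for a sampled entry `(a, b)`
and a weight `w`. -/
noncomputable def summand (V : Matrix (Fin n) (Fin k) ℂ) (w : ℂ) (a b : Fin n) (i j : Fin k) : ℂ :=
  star (V a i) * V b j * w + star (V b i) * V a j * star w

theorem triple_addEntry (hs : Addressed s) (a b : Fin n) (i j : Fin k) (w : ℂ)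
    (ha : s.x 11 = a) (hb : s.x 12 = b) (hi : s.x 8 = i) (hj : s.x 9 = j)
    (h13 : 16 ≤ s.x 13) (hw : s.c 7 = w) :
    Triple O fuel .addEntry s v fun s' v' => v' = v ∧
      s'.x 9 = j + 1 ∧ s'.x 13 = s.x 13 + 1 ∧ (∀ q, q ≠ 9 → q ≠ 13 → s'.x q = s.x q) ∧
      (∀ q, q ≠ s.x 13 → q ≠ 10 → q ≠ 11 → s'.c q = s.c q) ∧
      s'.c (s.x 13) = s.c (s.x 13) + summand O.V w a b i j ∧
      s'.t = s.t + (11 + 4 * O.p) := by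
  obtain ⟨x0, x4, x5, x20, x21, x22, x23, x24, x25, x26, x27, x28, x29, x30, x31, x32⟩ := hs
  obtain ⟨d, hd⟩ : ∃ d, s.x 13 = d := ⟨_, rfl⟩
  rw [hd] at h13
  -- The accumulator cell must not alias the weight (7) or the scratch cells (10, 11).
  have d7 : d ≠ 7 := by omega
  have d10 : d ≠ 10 := by omega
  have d11 : d ≠ 11 := by omega
  refine .seq <| .entryV_of a i (by simpa) (by simpa) <| .seq <| .conj <|
    .seq <| .entryV_of b j ?_ ?_ <| .seq <| .num <| .seq <| .num <| .seq <| .num <|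
    .seq <| .entryV_of b i ?_ ?_ <| .seq <| .conj <| .seq <| .entryV_of a j ?_ ?_ <|
    .seq <| .num <| .seq <| .conj <| .seq <| .num <| .seq <| .num <| .seq <| .int <| .int ?_
  iterate 6 simp [State.setNum, State.tick, State.num, *]
  simp +contextual [State.setInt, State.setNum, State.tick, State.num, NumOp.eval, IntOp.eval,
      summand, d7.symm, *]
  constructor <;> ring

theorem triple_addRow (hs : Addressed s) (hfuel : k < fuel) (a b : Fin n) (i : Fin k) (w : ℂ)
    (ha : s.x 11 = a) (hb : s.x 12 = b) (hk : s.x 2 = k) (hi : s.x 8 = i)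
    (h13 : s.x 13 = 16 + i * k) (hw : s.c 7 = w) :
    Triple O fuel .addRow s v fun s' v' => v' = v ∧
      s'.x 8 = i + 1 ∧ s'.x 13 = 16 + (i + 1) * k ∧
      (∀ q, q ≠ 8 → q ≠ 9 → q ≠ 13 → s'.x q = s.x q) ∧
      (∀ q, (q < 16 + i * k ∨ 16 + i * k + k ≤ q) → q ≠ 10 → q ≠ 11 → s'.c q = s.c q) ∧
      (∀ j : Fin k, s'.c (16 + i * k + j) = s.c (16 + i * k + j) + summand O.V w a b i j) ∧
      s'.t = s.t + (3 + k * (12 + 4 * O.p)) := by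
  have hx := hs
  refine .seq <| .const <| .seq ?_
  refine .loop (fun j s' v' => v' = v ∧ s'.x 9 = j ∧ s'.x 13 = 16 + i * k + j ∧
      (∀ q, q ≠ 9 → q ≠ 13 → s'.x q = s.x q) ∧
      (∀ q, (q < 16 + i * k ∨ 16 + i * k + k ≤ q) → q ≠ 10 → q ≠ 11 → s'.c q = s.c q) ∧
      (∀ j' : Fin k, s'.c (16 + i * k + j') = s.c (16 + i * k + j') +
        if (j' : ℕ) < j then summand O.V w a b i j' else 0) ∧
      s'.t = s.t + (1 + j * (12 + 4 * O.p))) k hfuel ?_ ?_ ?_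
  · simp +contextual [State.setInt, State.tick, h13]
  · rintro j s' v' hj ⟨rfl, h9, h13', hX, hC, hacc, ht⟩
    refine ⟨by simp [Test.Holds, h9, hX, hk, hj], ?_⟩
    refine (triple_addEntry (s := s'.tick 1) (hx.of_eq (hX _ (by simp) (by simp))
      (hX _ (by simp) (by simp)) (hX _ (by simp) (by simp)) fun q hq => hX _ (by omega) (by omega))
      a b i ⟨j, hj⟩ w ((hX _ (by simp) (by simp)).trans ha) ((hX _ (by simp) (by simp)).trans hb)
      ((hX _ (by simp) (by simp)).trans hi) h9 (by simp only [State.tick]; omega)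
      ((hC 7 (by omega) (by simp) (by simp)).trans hw)).mono ?_
    rintro s'' v'' ⟨rfl, h9', h13'', hX', hC', hacc', ht'⟩
    simp only [State.tick, h13'] at h13'' hX' hC' hacc' ht'
    refine ⟨rfl, h9', by omega, fun q h1 h2 => (hX' q h1 h2).trans (hX q h1 h2),
      fun q h1 h2 h3 => (hC' q (by omega) h2 h3).trans (hC q h1 h2 h3), fun j' => ?_, ?_⟩
    · by_cases hjj : (j' : ℕ) = j
      · obtain rfl : j' = ⟨j, hj⟩ := Fin.ext hjj
        rw [hacc', if_pos (Nat.lt_succ_self _)]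
        have := hacc ⟨j, hj⟩
        rw [if_neg (lt_irrefl _), add_zero] at this
        rw [this]
      · rw [hC' _ (by omega) (by omega) (by omega), hacc]
        congr 1
        exact if_congr (by omega) rfl rfl
    · rw [ht', ht]; push_cast; ring
  · rintro s' v' ⟨rfl, h9, h13', hX, hC, hacc, ht⟩
    refine ⟨by simp [Test.Holds, h9, hX, hk], .int ?_⟩
    have h5 : s'.x 5 = 1 := (hX _ (by simp) (by simp)).trans hx.x5
    have h8 : s'.x 8 = i := (hX _ (by simp) (by simp)).trans hi
    refine ⟨rfl, ?_, ?_, fun q h1 h2 h3 => ?_, hC, fun j => ?_, ?_⟩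
    · simp [State.setInt, State.tick, IntOp.eval, h8, h5]
    · simp [State.setInt, State.tick, h13']; ring
    · simp [State.setInt, State.tick, h1, hX q h2 h3]
    · exact (hacc j).trans (by rw [if_pos j.2])
    · simp only [State.setInt, State.tick, ht]; ring

theorem triple_addEst (hs : Addressed s) (hfuel : k < fuel) (a b : Fin n) (w : ℂ)
    (ha : s.x 11 = a) (hb : s.x 12 = b) (hk : s.x 2 = k) (hw : s.c 7 / s.c 6 = w) :
    Triple O fuel .addEst s v fun s' v' => v' = v ∧
      (∀ q, q ≠ 8 → q ≠ 9 → q ≠ 13 → s'.x q = s.x q) ∧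
      (∀ q, q < 16 → q ≠ 7 → q ≠ 10 → q ≠ 11 → s'.c q = s.c q) ∧
      (∀ i j : Fin k, s'.c (16 + i * k + j) = s.c (16 + i * k + j) + summand O.V w a b i j) ∧
      s'.t = s.t + (4 + k * (4 + k * (12 + 4 * O.p))) := by
  have hx := hs
  obtain ⟨x0, x4, x5, x20, x21, x22, x23, x24, x25, x26, x27, x28, x29, x30, x31, x32⟩ := hs
  refine .seq <| .num <| .seq <| .const <| .seq <| .int ?_
  refine .loop (fun i s' v' => v' = v ∧ s'.x 8 = i ∧ s'.x 13 = 16 + i * k ∧ s'.c 7 = w ∧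
      (∀ q, q ≠ 8 → q ≠ 9 → q ≠ 13 → s'.x q = s.x q) ∧
      (∀ q, q < 16 → q ≠ 7 → q ≠ 10 → q ≠ 11 → s'.c q = s.c q) ∧
      (∀ i' j' : Fin k, s'.c (16 + i' * k + j') = s.c (16 + i' * k + j') +
        if (i' : ℕ) < i then summand O.V w a b i' j' else 0) ∧
      s'.t = s.t + (3 + i * (4 + k * (12 + 4 * O.p)))) k hfuel ?_ ?_ ?_
  · refine ⟨rfl, ?_, ?_, ?_, ?_, ?_, ?_, ?_⟩
    · simp [State.setInt, State.setNum, State.tick]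
    · simp [State.setInt, State.setNum, State.tick, IntOp.eval, x0, x4]
    · simp [State.setInt, State.setNum, State.tick, State.num, NumOp.eval, x27, x26, hw]
    · simp +contextual [State.setInt, State.setNum, State.tick]
    · simp +contextual [State.setInt, State.setNum, State.tick, x27]
    · intro i' j'
      have : 16 + (i' : ℕ) * k + j' ≠ 7 := by omega
      simp [State.setInt, State.setNum, State.tick, x27, this]
    · simp only [State.setInt, State.setNum, State.tick]; push_cast; ring
  · rintro i s' v' hi ⟨rfl, h8, h13, h7, hX, hC, hacc, ht⟩
    refine ⟨by simp [Test.Holds, h8, hX, hk, hi], ?_⟩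
    refine (triple_addRow (s := s'.tick 1) (hx.of_eq (hX _ (by simp) (by simp) (by simp))
      (hX _ (by simp) (by simp) (by simp)) (hX _ (by simp) (by simp) (by simp))
      fun q hq => hX _ (by omega) (by omega) (by omega)) hfuel
      a b ⟨i, hi⟩ w ((hX _ (by simp) (by simp) (by simp)).trans ha)
      ((hX _ (by simp) (by simp) (by simp)).trans hb)
      ((hX _ (by simp) (by simp) (by simp)).trans hk) h8 h13 h7).mono ?_
    rintro s'' v'' ⟨rfl, h8', h13', hX', hC', hacc', ht'⟩
    simp only [State.tick] at h13' hX' hC' hacc' ht'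
    refine ⟨rfl, h8', h13', (hC' 7 (by omega) (by simp) (by simp)).trans h7,
      fun q h1 h2 h3 => (hX' q h1 h2 h3).trans (hX q h1 h2 h3),
      fun q h1 h2 h3 h4 => (hC' q (by omega) h3 h4).trans (hC q h1 h2 h3 h4), fun i' j' => ?_, ?_⟩
    -- Rows occupy disjoint blocks of `k` consecutive addresses, so only row `i` is touched in this
    -- round.
    · rcases lt_trichotomy (i' : ℕ) i with hlt | heq | hgt
      · have h1 : ((i' : ℕ) + 1) * k ≤ i * k := Nat.mul_le_mul_right k hlt
        rw [Nat.succ_mul] at h1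
        rw [hC' _ (by left; omega) (by omega) (by omega), hacc, if_pos hlt, if_pos (by omega)]
      · obtain rfl : i' = ⟨i, hi⟩ := Fin.ext heq
        have h2 := hacc ⟨i, hi⟩ j'
        rw [if_neg (lt_irrefl _), add_zero] at h2
        have h3 := hacc' j'
        rw [if_pos (Nat.lt_succ_self _), h3, h2]
      · have h1 : (i + 1) * k ≤ (i' : ℕ) * k := Nat.mul_le_mul_right k hgt
        rw [Nat.succ_mul] at h1
        rw [hC' _ (by right; omega) (by omega) (by omega), hacc, if_neg (by omega),
          if_neg (by omega)]
    · rw [ht', ht]; push_cast; ring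
  · rintro s' v' ⟨rfl, h8, h13, h7, hX, hC, hacc, ht⟩
    refine ⟨by simp [Test.Holds, h8, hX, hk], rfl, hX, hC, fun i j => ?_, ?_⟩
    · exact (hacc i j).trans (by rw [if_pos i.2])
    · rw [State.tick, ht]; ring

/-- Dividing the weight by `2 * M` performs both the halving in the Hermitian part and the averaging
over samples. -/
theorem summand_eq (A : Matrix (Fin n) (Fin n) ℂ) (V : Matrix (Fin n) (Fin k) ℂ) (M : ℕ)
    (a b : Fin n) (i j : Fin k) :
    summand V (weight A a b / (2 * M)) a b i j = symEst A V a b i j / M := by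
  simp only [summand, symEst, rawEst, Matrix.smul_apply, Matrix.add_apply, Matrix.of_apply,
    Matrix.conjTranspose_apply, star_mul', star_star, star_div₀, star_natCast, star_ofNat,
    Complex.real_smul]
  push_cast
  ring

/-- The time bound for processing one sampled entry. -/
noncomputable def entryTime (n k p : ℕ) : ℝ :=
  17 + Real.log n + k * (12 + 2 * p) + k * k * (12 + 4 * p)

/-- The number tested against `B2` is `estSq`, which is real, so comparing real parts decides
exactly the case distinction in `clipEst`. The time is an upper bound covering both branches. -/
theorem triple_useEntry (hs : Addressed s) (hfuel : k < fuel) (l : Fin τ) (a b : Fin n) {B2 : ℝ}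
    {M : ℕ} (hl : s.x 6 = l) (ha : s.x 11 = a) (hb : s.x 12 = b) (hk : s.x 2 = k)
    (h7 : s.c 7 = (frobNorm (O.A l) : ℝ)) (h4 : s.c 4 = (B2 : ℝ)) (h6 : s.c 6 = 2 * M) :
    Triple O fuel .useEntry s v fun s' v' => v' = v ∧
      (∀ q, q ≠ 8 → q ≠ 9 → q ≠ 13 → q ≠ 14 → s'.x q = s.x q) ∧
      (∀ q, q < 16 → q ≠ 7 → q ≠ 8 → q ≠ 9 → q ≠ 10 → q ≠ 11 → s'.c q = s.c q) ∧
      (∀ i j : Fin k, s'.c (16 + i * k + j) =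
        s.c (16 + i * k + j) + clipEst (O.A l) O.V B2 a b i j / M) ∧
      s'.t ≤ s.t + entryTime n k O.p := by
  have hx := hs
  obtain ⟨x0, x4, x5, x20, x21, x22, x23, x24, x25, x26, x27, x28, x29, x30, x31, x32⟩ := hs
  refine .seq <| .num <| .seq <| .entry_of l a b ?_ ?_ ?_ <| .seq <| .conj <| .seq <| .num <|
    .seq_of (R := fun s' v' => v' = v ∧ (∀ q, q ≠ 8 → s'.x q = s.x q) ∧
      (∀ q, q ≠ 7 → q ≠ 8 → q ≠ 9 → q ≠ 10 → q ≠ 11 → s'.c q = s.c q) ∧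
      s'.c 7 = weight (O.A l) a b ∧
      s'.c 8 = (rowNorm O.V a ^ 2 : ℝ) ∧ s'.c 9 = (rowNorm O.V b ^ 2 : ℝ) ∧
      s'.t = s.t + (8 + Real.log n + k * (8 + 2 * O.p))) ?_ ?_
  iterate 3 simp [State.setNum, State.tick, *]
  · refine (triple_rowNorms ?_ hfuel a b ?_ ?_ ?_).mono ?_
    · exact hx.of_eq rfl rfl rfl fun _ _ => rfl
    iterate 3 simp [State.setNum, State.tick, *]
    · rintro s' v' ⟨rfl, hX, hC, hc8, hc9, ht⟩
      refine ⟨rfl, hX, fun q h1 h2 h3 h4 h5 => ?_, ?_, hc8, hc9, ?_⟩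
      · rw [hC q h2 h3 h4 h5]
        simp [State.setNum, State.tick, *]
      · rw [hC 7 (by simp) (by simp) (by simp) (by simp)]
        simp [State.setNum, State.tick, State.num, NumOp.eval, weight, *]
      · rw [ht]
        simp only [State.setNum, State.tick]
        ring
  · rintro s' v' ⟨rfl, hX, hC, hc7, hc8, hc9, ht⟩
    have hx' : Addressed s' := hx.of_eq (hX _ (by simp)) (hX _ (by simp)) (hX _ (by simp))
      fun q hq => hX _ (by omega)
    have y24 := hx'.x24
    have y27 := hx'.x27
    have y28 := hx'.x28
    have y29 := hx'.x29
    have y30 := hx'.x30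
    have hc4 : s'.c 4 = (B2 : ℝ) := by rw [hC 4] <;> simp [h4]
    have hc6 : s'.c 6 = 2 * M := by rw [hC 6] <;> simp [h6]
    have hacc0 : ∀ i j : Fin k, s'.c (16 + i * k + j) = s.c (16 + i * k + j) := fun i j =>
      hC _ (by omega) (by omega) (by omega) (by omega) (by omega)
    have hest : (star (weight (O.A l) a b) * weight (O.A l) a b *
        (rowNorm O.V a ^ 2 : ℝ) * (rowNorm O.V b ^ 2 : ℝ) : ℂ) = (estSq (O.A l) O.V a b : ℝ) := by
      rw [estSq, Complex.star_def, Complex.conj_mul']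
      push_cast; ring
    refine .seq <| .conj <| .seq <| .num <| .seq <| .num <| .seq <| .num ?_
    simp only [List.foldr_nil]
    set s1 : State := State.setNum _ _ _ with hs1
    have e10 : s1.c 10 = (estSq (O.A l) O.V a b : ℝ) := by
      rw [← hest]
      simp [hs1, State.setNum, State.tick, State.num, NumOp.eval, y27, y28, y29, y30, hc7, hc8, hc9]
    have eX : ∀ q, s1.x q = s'.x q := fun q => rfl
    have eC : ∀ q, q ≠ 10 → s1.c q = s'.c q := fun q hq => by
      simp [hs1, State.setNum, State.tick, y30, hq]
    have et : s1.t = s'.t + 4 := by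
      simp only [hs1, State.setNum, State.tick]; ring
    clear_value s1
    have hx1 : Addressed s1 := hx'.of_eq (eX _) (eX _) (eX _) fun _ _ => eX _
    have hp : (0 : ℝ) ≤ O.p := Nat.cast_nonneg _
    have hk0 : (0 : ℝ) ≤ k := Nat.cast_nonneg _
    have hkp : (0 : ℝ) ≤ k * O.p := mul_nonneg hk0 hp
    have hkkp : (0 : ℝ) ≤ k * k * O.p := mul_nonneg (mul_nonneg hk0 hk0) hp
    have hholds : Test.Holds (.numLe 30 24) s1 ↔ estSq (O.A l) O.V a b ≤ B2 := by
      simp [Test.Holds, State.num, hx1.x30, hx1.x24, e10, eC 4, hc4]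
    refine .cond (fun hle => ?_) fun hle => ?_
    · rw [hholds] at hle
      refine (triple_addEst (s := s1.tick 1) (hx1.of_eq rfl rfl rfl fun _ _ => rfl) hfuel a b
        (weight (O.A l) a b / (2 * M)) ((eX _).trans ((hX _ (by simp)).trans ha))
        ((eX _).trans ((hX _ (by simp)).trans hb)) ((eX _).trans ((hX _ (by simp)).trans hk))
        (by simp only [State.tick, eC 7 (by simp), eC 6 (by simp), hc7, hc6])).mono ?_
      · rintro s'' v'' ⟨rfl, hX', hC', hacc', ht'⟩
        refine ⟨rfl, fun q h1 h2 h3 h4 => ?_, fun q h1 h2 h3 h4 h5 h6 => ?_, fun i j => ?_, ?_⟩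
        · exact (hX' q h1 h2 h3).trans ((eX q).trans (hX q h1))
        · exact (hC' q h1 h2 h5 h6).trans ((eC q h5).trans (hC q h2 h3 h4 h5 h6))
        · rw [hacc', clipEst, if_pos hle, ← summand_eq, ← hacc0, ← eC _ (by omega)]; rfl
        · rw [ht', State.tick, et, ht, entryTime]; linarith
    · rw [hholds] at hle
      refine .const ⟨rfl, fun q h1 h2 h3 h4 => ?_, fun q h1 h2 h3 h4 h5 h6 => ?_,
        fun i j => ?_, ?_⟩
      · simp [State.setInt, State.tick, eX, h4, hX q h1]
      · exact (eC q h5).trans (hC q h2 h3 h4 h5 h6)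
      · rw [clipEst, if_neg hle, Matrix.zero_apply, zero_div, add_zero, ← hacc0]
        exact eC _ (by omega)
      · simp only [State.setInt, State.tick, et, ht, entryTime]
        nlinarith [mul_nonneg hk0 hk0]

/-- The registers on which the sampling loops rely: `τ`, `k`, the number `M` of samples, and the
threshold `B2` for clipping. -/
structure Prepared (τ k M : ℕ) (B2 : ℝ) (s : State) : Prop where
  addr : Addressed s
  x1 : s.x 1 = τ
  x2 : s.x 2 = k
  x10 : s.x 10 = M
  c4 : s.c 4 = (B2 : ℝ)
  c6 : s.c 6 = 2 * M
  c12 : s.c 12 = 0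

/-- The accumulator holds the Hermitian matrix `S / M`. -/
def Accumulated (M : ℕ) (S : Matrix (Fin k) (Fin k) ℂ) (s : State) : Prop :=
  S.IsHermitian ∧ ∀ i j : Fin k, s.c (16 + i * k + j) = S i j / M

/-- `Ψ` is the bound to be carried after the sample, as a function of the accumulated sum. The test
for a zero matrix comes first because sampling from one makes the run fail; hence the two separate
hypotheses on `v`. -/
theorem triple_sample {M : ℕ} {B2 : ℝ} (hs : Prepared τ k M B2 s) (hfuel : k < fuel) (l : Fin τ)
    (hl : s.x 6 = l) {S : Matrix (Fin k) (Fin k) ℂ} (hS : Accumulated M S s)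
    {Ψ : Matrix (Fin k) (Fin k) ℂ → ℝ} (h0 : frobNorm (O.A l) = 0 → v ≤ Ψ S)
    (h1 : frobNorm (O.A l) ≠ 0 → v ≤ ∑ a, rowProb (O.A l) a *
      ∑ b, entryProb (O.A l) a b * Ψ (S + clipEst (O.A l) O.V B2 a b)) :
    Triple O fuel .sample s v fun s' v' => Prepared τ k M B2 s' ∧ s'.x 6 = l ∧
      s'.x 7 = s.x 7 ∧ (∃ S', Accumulated M S' s' ∧ v' ≤ Ψ S') ∧
      s'.t ≤ s.t + (4 + 3 * Real.log n + entryTime n k O.p) := by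
  have hx := hs.addr
  have hlog : 0 ≤ Real.log n := Real.log_natCast_nonneg n
  refine .seq <| .frob_of l hl ?_
  set s1 : State := State.setNum _ _ _ with hs1
  have e7 : s1.c 7 = (frobNorm (O.A l) : ℝ) := by simp [hs1, State.setNum, State.tick, hx.x27]
  have eX : ∀ q, s1.x q = s.x q := fun q => rfl
  have eC : ∀ q, q ≠ 7 → s1.c q = s.c q := fun q hq => by
    simp [hs1, State.setNum, State.tick, hx.x27, hq]
  have et : s1.t = s.t + (1 + Real.log n) := rfl
  clear_value s1
  have hholds : Test.Holds (.numLe 27 32) s1 ↔ frobNorm (O.A l) = 0 := by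
    simp only [Test.Holds, State.num, eX, hx.x27, hx.x32, e7, eC 12 (by simp), hs.c12,
      Complex.ofReal_re, Complex.zero_re]
    exact ⟨fun h => le_antisymm h (frobNorm_nonneg _), fun h => h.le⟩
  refine .cond (fun hz => ?_) fun hz => ?_
  · rw [hholds] at hz
    refine .const ⟨⟨?_, ?_, ?_, ?_, ?_, ?_, ?_⟩, ?_, ?_, ⟨S, ⟨hS.1, fun i j => ?_⟩, h0 hz⟩, ?_⟩
    · refine hx.of_eq ?_ ?_ ?_ fun q hq => ?_
      iterate 3 simp [State.setInt, State.tick, eX]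
      have : q ≠ 14 := by omega
      simp [State.setInt, State.tick, eX, this]
    iterate 3 simp [State.setInt, State.tick, eX, hs.x1, hs.x2, hs.x10]
    iterate 3 simp [State.setInt, State.tick, eC, hs.c4, hs.c6, hs.c12]
    iterate 2 simp [State.setInt, State.tick, eX, hl]
    · exact (eC _ (by omega)).trans (hS.2 i j)
    · simp only [State.setInt, State.tick, et, entryTime]
      have : (0 : ℝ) ≤ k * (12 + 2 * O.p) + k * k * (12 + 4 * O.p) := by positivity
      linarith
  · rw [hholds] at hz
    refine .seq <| .sampleRow_of l ((eX 6).trans hl) _ (h1 hz) fun a _ => ?_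
    refine .seq <| .sampleEntry_of l a (by simp [State.setInt, State.tick, eX, hl])
      (by simp [State.setInt]) _ le_rfl fun b _ => ?_
    simp only [List.foldr_nil]
    set s2 : State := State.setInt _ _ _ with hs2
    have fX : ∀ q, q ≠ 11 → q ≠ 12 → s2.x q = s.x q := fun q h1 h2 => by
      simp [hs2, State.setInt, State.tick, eX, h1, h2]
    have f11 : s2.x 11 = a := by simp [hs2, State.setInt, State.tick]
    have f12 : s2.x 12 = b := by simp [hs2, State.setInt, State.tick]
    have fC : ∀ q, s2.c q = s1.c q := fun q => rfl
    have ft : s2.t = s.t + (4 + 3 * Real.log n) := by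
      simp only [hs2, State.setInt, State.tick, et]; ring
    clear_value s2
    have hx2 : Addressed s2 := hx.of_eq (fX _ (by simp) (by simp)) (fX _ (by simp) (by simp))
      (fX _ (by simp) (by simp)) fun q hq => fX _ (by omega) (by omega)
    refine (triple_useEntry hx2 hfuel l a b (B2 := B2) (M := M) ?_ f11 f12 ?_ ?_ ?_ ?_).mono ?_
    iterate 2 simp [fX, hl, hs.x2]
    · rw [fC, e7]
    iterate 2 simp [fC, eC, hs.c4, hs.c6]
    rintro s' v' ⟨rfl, hX, hC, hacc, ht⟩
    refine ⟨⟨?_, ?_, ?_, ?_, ?_, ?_, ?_⟩, ?_, ?_, ⟨_, ⟨hS.1.add (isHermitian_clipEst _ a b),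
      fun i j => ?_⟩, le_rfl⟩, ?_⟩
    · exact hx2.of_eq (hX _ (by simp) (by simp) (by simp) (by simp))
        (hX _ (by simp) (by simp) (by simp) (by simp))
        (hX _ (by simp) (by simp) (by simp) (by simp))
        fun q hq => hX _ (by omega) (by omega) (by omega) (by omega)
    iterate 3 simp [hX, fX, hs.x1, hs.x2, hs.x10]
    iterate 3 simp [hC, fC, eC, hs.c4, hs.c6, hs.c12]
    iterate 2 simp [hX, fX, hl]
    · rw [hacc, fC, eC _ (by omega), hS.2, Matrix.add_apply, add_div]
    · linarith

/-- The time bound for all samples from one matrix. -/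
noncomputable def matrixTime (n k p M : ℕ) : ℝ :=
  M * (6 + 3 * Real.log n + entryTime n k p) + 3

theorem triple_sampleMatrix {M : ℕ} {B2 : ℝ} (hs : Prepared τ k M B2 s) (hfuel : k < fuel)
    (hM : M < fuel) (l : Fin τ) (hl : s.x 6 = l) {S : Matrix (Fin k) (Fin k) ℂ}
    (hS : Accumulated M S s) (Ψ : ℕ → Matrix (Fin k) (Fin k) ℂ → ℝ) (hv : v ≤ Ψ 0 S)
    (h0 : ∀ m S, m < M → frobNorm (O.A l) = 0 → Ψ m S ≤ Ψ (m + 1) S)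
    (h1 : ∀ m S, m < M → frobNorm (O.A l) ≠ 0 → Ψ m S ≤ ∑ a, rowProb (O.A l) a *
      ∑ b, entryProb (O.A l) a b * Ψ (m + 1) (S + clipEst (O.A l) O.V B2 a b)) :
    Triple O fuel .sampleMatrix s v fun s' v' => Prepared τ k M B2 s' ∧ s'.x 6 = l + 1 ∧
      (∃ S', Accumulated M S' s' ∧ v' ≤ Ψ M S') ∧ s'.t ≤ s.t + matrixTime n k O.p M := by
  refine .seq <| .const <| .seq ?_
  have hprep : ∀ {s s' : State}, Prepared τ k M B2 s → (∀ q, q ≠ 6 → q ≠ 7 → s'.x q = s.x q) →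
      s'.c = s.c → Prepared τ k M B2 s' := fun h hX hC =>
    ⟨h.addr.of_eq (hX _ (by simp) (by simp)) (hX _ (by simp) (by simp)) (hX _ (by simp) (by simp))
      fun q hq => hX _ (by omega) (by omega), by simp [hX, h.x1], by simp [hX, h.x2],
      by simp [hX, h.x10], by simp [hC, h.c4], by simp [hC, h.c6], by simp [hC, h.c12]⟩
  refine .loop (fun m s' v' => Prepared τ k M B2 s' ∧ s'.x 6 = l ∧ s'.x 7 = m ∧
      (∃ S', Accumulated M S' s' ∧ v' ≤ Ψ m S') ∧
      s'.t ≤ s.t + (1 + m * (6 + 3 * Real.log n + entryTime n k O.p))) M hM ?_ ?_ ?_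
  · refine ⟨hprep hs (fun q h6 h7 => ?_) rfl, ?_, ?_, ⟨S, hS, hv⟩, ?_⟩
    · simp [State.setInt, State.tick, h7]
    iterate 2 simp [State.setInt, State.tick, hl]
    · simp [State.setInt, State.tick]
  · rintro m s' v' hm ⟨hp, h6, h7, ⟨S', hS', hv'⟩, ht⟩
    refine ⟨by simp [Test.Holds, h7, hp.x10, hm], ?_⟩
    refine .seq_of (triple_sample (s := s'.tick 1) (Ψ := Ψ (m + 1)) (hprep hp (fun _ _ _ => rfl)
      rfl) hfuel l h6 hS' (fun h => hv'.trans (h0 m S' hm h))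
      (fun h => hv'.trans (h1 m S' hm h))) ?_
    rintro s'' v'' ⟨hp', h6', h7', ⟨S'', hS'', hv''⟩, ht'⟩
    have h5 := hp'.addr.x5
    refine .int ⟨hprep hp' (fun q h6 h7 => ?_) rfl, ?_, ?_, ⟨S'', hS'', hv''⟩, ?_⟩
    · simp [State.setInt, State.tick, h7]
    · simp [State.setInt, State.tick, h6']
    · simp only [State.tick] at h7'
      simp [State.setInt, State.tick, IntOp.eval, h7', h7, h5]
    · simp only [State.setInt, State.tick] at ht' ⊢
      push_cast
      linarith
  · rintro s' v' ⟨hp, h6, h7, hS', ht⟩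
    refine ⟨by simp [Test.Holds, h7, hp.x10], .int ⟨hprep hp (fun q h6 h7 => ?_) rfl, ?_,
      hS', ?_⟩⟩
    · simp [State.setInt, State.tick, h6]
    · simp [State.setInt, State.tick, IntOp.eval, h6, hp.addr.x5]
    · simp only [State.setInt, State.tick, matrixTime]
      linarith

theorem triple_addresses (h4 : s.x 4 = 0) (h20 : s.x 20 = 0) :
    Triple O fuel .addresses s v fun s' v' => v' = v ∧ Addressed s' ∧
      (∀ q, q ≠ 0 → q ≠ 5 → q < 20 → s'.x q = s.x q) ∧ s'.c = s.c ∧ s'.t = s.t + 14 := by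
  refine .seq <| .const <| .seq <| .const <| .seq <| .const <| .seq <| .const <| .seq <| .const <|
    .seq <| .const <| .seq <| .const <| .seq <| .const <| .seq <| .const <| .seq <| .const <|
    .seq <| .const <| .seq <| .const <| .seq <| .const <| .const ⟨rfl, ?_, ?_, rfl, ?_⟩
  · constructor <;> simp [State.setInt, State.tick, h4, h20]
  · intro q h0 h5 hq
    have h : ∀ a, 20 ≤ a → q ≠ a := fun a ha => by omega
    simp [State.setInt, State.tick, h0, h5, h]
  · simp only [State.setInt, State.tick]; ring

theorem triple_parameters (hs : Addressed s) {r : ℕ} {ε : ℝ} (h1 : s.x 1 = τ) (h3 : s.x 3 = r)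
    (h0 : s.c 0 = (ε : ℂ)) :
    Triple O fuel .parameters s v fun s' v' => v' = v ∧ (∀ q, q ≠ 14 → s'.x q = s.x q) ∧
      (∀ q, q ≠ 2 → q ≠ 3 → q ≠ 4 → q ≠ 5 → s'.c q = s.c q) ∧
      s'.c 2 = (64 * r ^ 3 * τ * (400 * r ^ 2 / ε) ^ 2 : ℝ) ∧ s'.c 3 = 0 ∧
      s'.c 4 = (64 * r ^ 6 * τ ^ 2 * (400 * r ^ 2 / ε) ^ 2 : ℝ) ∧ s'.c 5 = 2 ∧
      s'.t = s.t + 24 := by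
  obtain ⟨x0, x4, x5, x20, x21, x22, x23, x24, x25, x26, x27, x28, x29, x30, x31, x32⟩ := hs
  refine .seq <| .const <| .seq <| .cast <| .seq <| .cast <| .seq <| .num <| .seq <| .num <|
    .seq <| .num <| .seq <| .num <| .seq <| .num <| .seq <| .num <| .seq <| .num <|
    .seq <| .num <| .seq <| .num <| .seq <| .num <| .seq <| .cast <| .seq <| .num <|
    .seq <| .num <| .seq <| .num <| .seq <| .const <| .seq <| .cast <| .seq <| .num <|
    .seq <| .num <| .seq <| .cast <| .seq <| .const <| .cast ?_
  refine ⟨rfl, ?_, ?_, ?_, ?_, ?_, ?_, ?_⟩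
  · simp +contextual [State.setInt, State.setNum, State.tick]
  · simp +contextual [State.setInt, State.setNum, State.tick, *]
  · simp [State.setInt, State.setNum, State.tick, State.num, NumOp.eval, *]
    ring
  · simp [State.setInt, State.setNum, State.tick, *]
  · simp [State.setInt, State.setNum, State.tick, State.num, NumOp.eval, *]
    ring
  · simp [State.setInt, State.setNum, State.tick, *]
  · simp only [State.setInt, State.setNum, State.tick]; ring

/-- `h` and `M` enter through the outcomes of the loop tests, so the loops make exactly `h` and `M`
rounds. -/
theorem triple_sampleCount (hs : Addressed s) {δ α : ℝ} {h M : ℕ} (hh : h < fuel) (hM : M < fuel)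
    (h10 : s.x 10 = 0) (h1 : s.c 1 = (δ : ℂ)) (h2 : s.c 2 = (α : ℂ)) (h3 : s.c 3 = 0)
    (h5 : s.c 5 = 2) (h6 : s.c 6 = 0) (hlt : ∀ i < h, δ * 2 ^ i ≤ 2) (hgt : 2 < δ * 2 ^ h)
    (Mlt : ∀ m < M, (m : ℝ) ≤ h * α) (Mgt : h * α < M) :
    Triple O fuel .sampleCount s v fun s' v' => v' = v ∧ s'.x 10 = M ∧
      (∀ q, q ≠ 10 → s'.x q = s.x q) ∧
      (∀ q, q ≠ 1 → q ≠ 3 → q ≠ 6 → s'.c q = s.c q) ∧ s'.c 6 = 2 * M ∧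
      s'.t = s.t + (3 + 3 * h + 3 * M) := by
  obtain ⟨x0, x4, x5, x20, x21, x22, x23, x24, x25, x26, x27, x28, x29, x30, x31, x32⟩ := hs
  refine .seq_of (R := fun s' v' => v' = v ∧ s'.x = s.x ∧ s'.c 3 = (h * α : ℝ) ∧
      (∀ q, q ≠ 1 → q ≠ 3 → s'.c q = s.c q) ∧ s'.t = s.t + (1 + 3 * h)) ?_ ?_
  · refine .loop (fun i s' v' => v' = v ∧ s'.x = s.x ∧ s'.c 1 = (δ * 2 ^ i : ℝ) ∧
      s'.c 3 = (i * α : ℝ) ∧ (∀ q, q ≠ 1 → q ≠ 3 → s'.c q = s.c q) ∧ s'.t = s.t + 3 * i) h hh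
      ?_ ?_ ?_
    · simp [h1, h3]
    · rintro i s' v' hi ⟨rfl, hX, hc1, hc3, hC, ht⟩
      have hc2 : s'.c 2 = (α : ℂ) := by rw [hC _ (by simp) (by simp), h2]
      refine ⟨?_, .seq <| .num <| .num ⟨rfl, ?_, ?_, ?_, ?_, ?_⟩⟩
      · simp only [Test.Holds, State.num, hX, x21, x25, hc1, hC 5 (by simp) (by simp), h5,
          Complex.ofReal_re]
        simpa using hlt i hi
      · simpa [State.setNum, State.tick] using hX
      · simp [State.setNum, State.tick, State.num, NumOp.eval, hX, x21, x22, x23, hc1]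
        ring
      · simp [State.setNum, State.tick, State.num, NumOp.eval, hX, x21, x22, x23, hc3, hc2]
        ring
      · intro q h1 h3
        simp [State.setNum, State.tick, hX, x21, x23, h1, h3, hC]
      · simp only [State.setNum, State.tick, ht]; push_cast; ring
    · rintro s' v' ⟨rfl, hX, hc1, hc3, hC, ht⟩
      refine ⟨?_, rfl, hX, hc3, hC, ?_⟩
      · simp only [Test.Holds, State.num, hX, x21, x25, hc1, hC 5 (by simp) (by simp), h5,
          Complex.ofReal_re]
        simpa using hgt
      · simp only [State.tick, ht]; ring
  · rintro s1 v1 ⟨rfl, hX1, hc3, hC1, ht1⟩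
    refine .seq ?_
    refine .loop (fun m s' v' => v' = v1 ∧ s'.x 10 = m ∧ (∀ q, q ≠ 10 → s'.x q = s.x q) ∧
      (∀ q, q ≠ 6 → s'.c q = s1.c q) ∧ s'.c 6 = m ∧ s'.t = s1.t + 3 * m) M hM ?_ ?_ ?_
    · simp [hX1, h10, hC1, h6]
    · rintro m s' v' hm ⟨rfl, hx10, hX, hC, hc6, ht⟩
      refine ⟨?_, .seq <| .int <| .cast ⟨rfl, ?_, ?_, ?_, ?_, ?_⟩⟩
      · simp only [Test.Holds, State.num, hX _ (show 26 ≠ 10 by simp), x26,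
          hX _ (show 23 ≠ 10 by simp), x23, hc6, hC 3 (by simp), hc3, Complex.ofReal_re,
          Complex.natCast_re]
        exact Mlt m hm
      · simp [State.setNum, State.setInt, State.tick, IntOp.eval, hx10, hX, x5]
      · intro q hq
        simp [State.setNum, State.setInt, State.tick, hq, hX]
      · intro q hq
        simp [State.setNum, State.setInt, State.tick, hX, x26, hq, hC]
      · simp [State.setNum, State.setInt, State.tick, IntOp.eval, hX, x26, x5, hx10]
      · simp only [State.setNum, State.setInt, State.tick, ht]; push_cast; ring
    · rintro s' v' ⟨rfl, hx10, hX, hC, hc6, ht⟩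
      refine ⟨?_, .num ⟨rfl, hx10, hX, ?_, ?_, ?_⟩⟩
      · simp only [Test.Holds, State.num, hX _ (show 26 ≠ 10 by simp), x26,
          hX _ (show 23 ≠ 10 by simp), x23, hc6, hC 3 (by simp), hc3, Complex.ofReal_re,
          Complex.natCast_re]
        exact not_le.2 Mgt
      · intro q h1 h3 h6
        simp [State.setNum, State.tick, hX, x26, h6, hC, hC1, h1, h3]
      · simp [State.setNum, State.tick, State.num, NumOp.eval, hX, x26, x25, hc6, hC, hC1, h5]
        ring
      · simp only [State.setNum, State.tick, ht, ht1]; ring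

/-- Any `Ψ` satisfying the one-step inequalities can be carried through the run. The condition
`hnext` identifies the end of one matrix with the start of the next. -/
theorem triple_approximate {r h M : ℕ} {ε δ : ℝ} (hfuel : k < fuel) (hτ : τ < fuel)
    (hh : h < fuel) (hM : M < fuel) (hlt : ∀ i < h, δ * 2 ^ i ≤ 2) (hgt : 2 < δ * 2 ^ h)
    (Mlt : ∀ m < M, (m : ℝ) ≤ h * (64 * r ^ 3 * τ * (400 * r ^ 2 / ε) ^ 2))
    (Mgt : h * (64 * r ^ 3 * τ * (400 * r ^ 2 / ε) ^ 2) < M)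
    (Ψ : ℕ → ℕ → Matrix (Fin k) (Fin k) ℂ → ℝ) (hv : v ≤ Ψ 0 0 0)
    (hnext : ∀ l S, l < τ → Ψ l M S = Ψ (l + 1) 0 S)
    (h0 : ∀ (l : Fin τ) m S, m < M → frobNorm (O.A l) = 0 → Ψ l m S ≤ Ψ l (m + 1) S)
    (h1 : ∀ (l : Fin τ) m S, m < M → frobNorm (O.A l) ≠ 0 → Ψ l m S ≤
      ∑ a, rowProb (O.A l) a * ∑ b, entryProb (O.A l) a b * Ψ l (m + 1)
        (S + clipEst (O.A l) O.V (64 * r ^ 6 * τ ^ 2 * (400 * r ^ 2 / ε) ^ 2) a b)) :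
    Triple O fuel .approximate (State.start n τ k r ε δ) v fun s' v' => s'.x 0 = 16 ∧
      (∃ S', Accumulated M S' s' ∧ v' ≤ Ψ τ 0 S') ∧
      s'.t ≤ 42 + 3 * h + 3 * M + τ * (1 + matrixTime n k O.p M) := by
  refine .seq_of (triple_addresses rfl rfl) ?_
  rintro s1 v1 ⟨rfl, hx1, hX1, hC1, ht1⟩
  refine .seq_of (triple_parameters (ε := ε) (r := r) hx1 (hX1 1 (by simp) (by simp) (by simp))
    (hX1 3 (by simp) (by simp) (by simp)) (by rw [hC1]; rfl)) ?_
  rintro s2 v2 ⟨rfl, hX2, hC2, c22, c23, c24, c25, ht2⟩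
  have hx2 : Addressed s2 := hx1.of_eq (hX2 _ (by simp)) (hX2 _ (by simp)) (hX2 _ (by simp))
    fun q hq => hX2 _ (by omega)
  have hzero : ∀ q, 6 ≤ q → s2.c q = 0 := fun q hq => by
    rw [hC2 q (by omega) (by omega) (by omega) (by omega), hC1]
    simp only [State.start]
    rw [if_neg (by omega), if_neg (by omega)]
  refine .seq_of (triple_sampleCount hx2 (δ := δ) hh hM ?_ ?_ c22 c23 c25 (hzero 6 le_rfl)
    hlt hgt Mlt Mgt) ?_
  · rw [hX2 _ (by simp), hX1 _ (by simp) (by simp) (by simp)]; rfl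
  · rw [hC2 _ (by simp) (by simp) (by simp) (by simp), hC1]; rfl
  rintro s3 v3 ⟨rfl, hx10, hX3, hC3, hc6, ht3⟩
  have hx3 : Addressed s3 := hx2.of_eq (hX3 _ (by simp)) (hX3 _ (by simp)) (hX3 _ (by simp))
    fun q hq => hX3 _ (by omega)
  have hX : ∀ q, q ≠ 0 → q ≠ 5 → q ≠ 10 → q ≠ 14 → q < 20 →
      s3.x q = (State.start n τ k r ε δ).x q := fun q h0 h5 h10 h14 hq => by
    rw [hX3 q h10, hX2 q h14, hX1 q h0 h5 hq]
  have hprep : Prepared τ k M (64 * r ^ 6 * τ ^ 2 * (400 * r ^ 2 / ε) ^ 2) s3 := by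
    refine ⟨hx3, ?_, ?_, hx10, ?_, hc6, ?_⟩
    · rw [hX] <;> simp [State.start]
    · rw [hX] <;> simp [State.start]
    · rw [hC3 _ (by simp) (by simp) (by simp), c24]
    · rw [hC3 _ (by simp) (by simp) (by simp), hzero _ (by simp)]
  have ht : s3.t = 41 + 3 * h + 3 * M := by
    rw [ht3, ht2, ht1]; simp only [State.start]; ring
  refine .loop (fun l s' v' => Prepared τ k M (64 * r ^ 6 * τ ^ 2 * (400 * r ^ 2 / ε) ^ 2) s' ∧
    s'.x 6 = l ∧ (∃ S', Accumulated M S' s' ∧ v' ≤ Ψ l 0 S') ∧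
    s'.t ≤ 41 + 3 * h + 3 * M + l * (1 + matrixTime n k O.p M)) τ hτ ?_ ?_ ?_
  · refine ⟨hprep, by rw [hX] <;> simp [State.start], ⟨0, ⟨Matrix.isHermitian_zero, fun i j => ?_⟩,
      hv⟩, by rw [ht]; simp⟩
    rw [hC3 _ (by omega) (by omega) (by omega), hzero _ (by omega)]
    simp
  · rintro l s' v' hl ⟨hp, h6, ⟨S', hS', hv'⟩, ht'⟩
    refine ⟨by simp [Test.Holds, h6, hp.x1, hl], ?_⟩
    refine (triple_sampleMatrix (s := s'.tick 1) ⟨hp.addr.of_eq rfl rfl rfl fun _ _ => rfl, hp.x1,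
      hp.x2, hp.x10, hp.c4, hp.c6, hp.c12⟩ hfuel hM ⟨l, hl⟩ h6 hS' (Ψ l) hv' (h0 ⟨l, hl⟩)
      (h1 ⟨l, hl⟩)).mono ?_
    rintro s'' v'' ⟨hp', h6', ⟨S'', hS'', hv''⟩, ht''⟩
    refine ⟨hp', h6', ⟨S'', hS'', hv''.trans_eq (hnext l S'' hl)⟩, ?_⟩
    simp only [State.tick] at ht''
    push_cast
    linarith
  · rintro s' v' ⟨hp, h6, hS', ht'⟩
    refine ⟨by simp [Test.Holds, h6, hp.x1], hp.addr.x0, hS', ?_⟩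
    simp only [State.tick]
    linarith

/-! ### Concentration of the accumulated estimators -/

section Potential

variable {n τ k : ℕ} (O : Access n τ k)

/-- The mean of the clipped estimator for the matrix `A l` (zero if there is no such matrix). -/
noncomputable def meanAt (b : ℝ) (l : ℕ) : Matrix (Fin k) (Fin k) ℂ :=
  if h : l < τ then clipMean (O.A ⟨l, h⟩) O.V b else 0

/-- The mean of the accumulator after `M` samples from each of the first `l` matrices, and `m`
samples from the next one. -/
noncomputable def meanSum (b : ℝ) (M l m : ℕ) : Matrix (Fin k) (Fin k) ℂ :=
  (M : ℝ) • ∑ i ∈ Finset.range l, meanAt O b i + (m : ℝ) • meanAt O b l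

/-- A lower bound for the probability that the accumulator will be close to its mean in the end. -/
noncomputable def potential (b lam ρ γ : ℝ) (M l m : ℕ) (S : Matrix (Fin k) (Fin k) ℂ) : ℝ :=
  1 - γ * ρ ^ ((τ - l) * M - m) * Real.cosh (lam * frobNorm (S - meanSum O b M l m))

variable {O} {B lam σ2 γ : ℝ} {M : ℕ}

theorem meanSum_succ (b : ℝ) (M l m : ℕ) :
    meanSum O b M l (m + 1) = meanSum O b M l m + meanAt O b l := by
  rw [meanSum, meanSum, Nat.cast_succ, add_smul, one_smul, add_assoc]

theorem potential_next (b ρ : ℝ) (l : ℕ) (S : Matrix (Fin k) (Fin k) ℂ) :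
    potential O b lam ρ γ M l M S = potential O b lam ρ γ M (l + 1) 0 S := by
  have h1 : meanSum O b M l M = meanSum O b M (l + 1) 0 := by
    rw [meanSum, meanSum, Finset.sum_range_succ, smul_add, Nat.cast_zero, zero_smul, add_zero]
  have h2 : (τ - l) * M - M = (τ - (l + 1)) * M - 0 := by
    rw [Nat.sub_zero, ← Nat.sub_sub, Nat.sub_one_mul]
  rw [potential, potential, h1, h2]

theorem exponent_succ {τ l M m : ℕ} (hl : l < τ) (hm : m < M) :
    (τ - l) * M - m = (τ - l) * M - (m + 1) + 1 := by
  have : M ≤ (τ - l) * M := Nat.le_mul_of_pos_left M (by omega)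
  omega

/-- For a zero matrix nothing is added and the mean is zero. The potential can only grow, since one
factor `ρ ≥ 1` is dropped. -/
theorem potential_le_of_frobNorm_eq_zero (hσ : 0 ≤ σ2) (hγ : 0 ≤ γ) {b : ℝ} (l : Fin τ) {m : ℕ}
    (S : Matrix (Fin k) (Fin k) ℂ) (hm : m < M) (hF : frobNorm (O.A l) = 0) :
    potential O b lam (1 + lam ^ 2 * σ2) γ M l m S ≤
      potential O b lam (1 + lam ^ 2 * σ2) γ M l (m + 1) S := by
  have h0 : meanAt O b l = 0 := by
    rw [meanAt, dif_pos l.2, clipMean]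
    refine Finset.sum_eq_zero fun q _ => ?_
    rw [rowProb, Fin.eta, hF]
    simp
  have hρ : 1 ≤ 1 + lam ^ 2 * σ2 := by nlinarith [mul_nonneg (sq_nonneg lam) hσ]
  rw [potential, potential, meanSum_succ, h0, add_zero, exponent_succ l.2 hm]
  refine sub_le_sub_left (mul_le_mul_of_nonneg_right (mul_le_mul_of_nonneg_left
    (pow_le_pow_right₀ hρ (Nat.le_succ _)) hγ) (Real.cosh_pos _).le) _

/-- The factor by which the exponential moment may grow in one sample is the factor `ρ` by which the
remaining allowance shrinks. -/
theorem potential_le (hσ : 0 ≤ σ2) (hγ : 0 ≤ γ) (hB : 0 ≤ B) (hlam : 0 ≤ lam)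
    (hlB : 2 * lam * B ≤ 1) (l : Fin τ)
    (hA : frobNorm (O.A l) ^ 2 * (frobNorm O.V ^ 2) ^ 2 ≤ σ2) {m : ℕ}
    (S : Matrix (Fin k) (Fin k) ℂ) (hm : m < M) (hF : frobNorm (O.A l) ≠ 0) :
    potential O (B ^ 2) lam (1 + lam ^ 2 * σ2) γ M l m S ≤
      ∑ a, rowProb (O.A l) a * ∑ b, entryProb (O.A l) a b *
        potential O (B ^ 2) lam (1 + lam ^ 2 * σ2) γ M l (m + 1)
          (S + clipEst (O.A l) O.V (B ^ 2) a b) := by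
  have hmean : meanAt O (B ^ 2) l = clipMean (O.A l) O.V (B ^ 2) := by rw [meanAt, dif_pos l.2]
  set ρ := 1 + lam ^ 2 * σ2 with hρ
  have hρ0 : 0 ≤ ρ := by positivity
  set e := (τ - l) * M - (m + 1) with he
  set T := S - meanSum O (B ^ 2) M l m with hT
  have hrw : ∀ a b, S + clipEst (O.A l) O.V (B ^ 2) a b - meanSum O (B ^ 2) M l (m + 1) =
      T + clipEst (O.A l) O.V (B ^ 2) a b - clipMean (O.A l) O.V (B ^ 2) := fun a b => by
    rw [meanSum_succ, hmean, hT]; abel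
  have hsum : ∑ a, rowProb (O.A l) a * ∑ b, entryProb (O.A l) a b *
        potential O (B ^ 2) lam ρ γ M l (m + 1) (S + clipEst (O.A l) O.V (B ^ 2) a b) =
      1 - γ * ρ ^ e * ∑ q : Fin n × Fin n, (rowProb (O.A l) q.1 * entryProb (O.A l) q.1 q.2) *
        Real.cosh (lam * frobNorm (T + clipEst (O.A l) O.V (B ^ 2) q.1 q.2 -
          clipMean (O.A l) O.V (B ^ 2))) := by
    conv_rhs => lhs; rw [← sum_rowProb_mul_entryProb hF]
    rw [Finset.mul_sum, ← Finset.sum_sub_distrib, Fintype.sum_prod_type]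
    refine Finset.sum_congr rfl fun a _ => ?_
    rw [Finset.mul_sum]
    refine Finset.sum_congr rfl fun b _ => ?_
    rw [potential, hrw, ← he]
    ring
  rw [hsum, potential, exponent_succ l.2 hm, ← he, pow_succ]
  have h := sum_cosh_clipEst_le hF hB hA hlam hlB T
  have h' := mul_le_mul_of_nonneg_left h (mul_nonneg hγ (pow_nonneg hρ0 e))
  linarith

/-- No samples remain, so the potential is `1 - cosh (λf) / cosh (λη)`, where `f` is the deviation.
It is positive only if `f < η`: this is Markov's inequality in pointwise form. -/
theorem frobNorm_le_of_potential_pos {b ρ η : ℝ} (hlam : 0 < lam) (hη : 0 ≤ η)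
    (S : Matrix (Fin k) (Fin k) ℂ)
    (h : 0 < potential O b lam ρ (Real.cosh (lam * η))⁻¹ M τ 0 S) :
    frobNorm (S - (M : ℝ) • ∑ i ∈ Finset.range τ, meanAt O b i) ≤ η := by
  by_contra hlt
  rw [not_le] at hlt
  rw [potential, meanSum, Nat.cast_zero, zero_smul, add_zero, Nat.sub_self, Nat.zero_mul,
    Nat.sub_zero, pow_zero, mul_one] at h
  set f := frobNorm (S - (M : ℝ) • ∑ i ∈ Finset.range τ, meanAt O b i)
  have hc : Real.cosh (lam * η) ≤ Real.cosh (lam * f) := by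
    rw [Real.cosh_le_cosh, abs_of_nonneg (by positivity), abs_of_nonneg (by nlinarith)]
    exact mul_le_mul_of_nonneg_left hlt.le hlam.le
  have := (one_le_inv_mul₀ (Real.cosh_pos (lam * η))).2 hc
  linarith

/-- Bias of the clipped means, summed over the `τ` matrices, plus the averaged fluctuation. -/
theorem frobNorm_sub_smul_le (hA : ∀ l, (O.A l).IsHermitian) (hB : 0 < B)
    (hσ : ∀ l, frobNorm (O.A l) ^ 2 * (frobNorm O.V ^ 2) ^ 2 ≤ σ2) {η : ℝ} (hM : 0 < M)
    {S : Matrix (Fin k) (Fin k) ℂ}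
    (hS : frobNorm (S - (M : ℝ) • ∑ i ∈ Finset.range τ, meanAt O (B ^ 2) i) ≤ M * η) :
    frobNorm (O.Vᴴ * (∑ l, O.A l) * O.V - (M : ℝ)⁻¹ • S) ≤ τ * (σ2 / B) + η := by
  have hM' : (0 : ℝ) < M := Nat.cast_pos.2 hM
  have h1 : O.Vᴴ * (∑ l, O.A l) * O.V - (M : ℝ)⁻¹ • S =
      ∑ l : Fin τ, (O.Vᴴ * O.A l * O.V - clipMean (O.A l) O.V (B ^ 2)) +
        (M : ℝ)⁻¹ • ((M : ℝ) • ∑ i ∈ Finset.range τ, meanAt O (B ^ 2) i - S) := by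
    have h2 : ∑ i ∈ Finset.range τ, meanAt O (B ^ 2) i =
        ∑ l : Fin τ, clipMean (O.A l) O.V (B ^ 2) := by
      rw [Finset.sum_range]
      exact Finset.sum_congr rfl fun l _ => by rw [meanAt, dif_pos l.2]
    rw [h2, smul_sub, smul_smul, inv_mul_cancel₀ hM'.ne', one_smul, Finset.sum_sub_distrib,
      Matrix.mul_sum, Matrix.sum_mul]
    abel
  rw [h1]
  refine (frobNorm_add_le _ _).trans (add_le_add ?_ ?_)
  · have h3 := frobNorm_sum_smul_le Finset.univ (p := fun _ : Fin τ => (1 : ℝ))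
      (fun _ => zero_le_one) fun l => O.Vᴴ * O.A l * O.V - clipMean (O.A l) O.V (B ^ 2)
    simp only [one_smul, one_mul] at h3
    refine h3.trans ((Finset.sum_le_sum fun l _ =>
      frobNorm_sub_clipMean_le (hA l) hB (hσ l)).trans_eq ?_)
    simp
  · rw [← norm_toVec, map_smul, norm_smul, norm_toVec, frobNorm_sub_comm, norm_inv,
      Real.norm_of_nonneg hM'.le, inv_mul_le_iff₀ hM']
    exact hS

end Potential

/-! ### The choice of parameters -/

/-- Here `(√k + κ)² ≤ r + r/2 + 1/16 ≤ 2r`. -/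
theorem variance_le {n k r : ℕ} (hr : 1 ≤ r) (hk : k ≤ r) {A : Matrix (Fin n) (Fin n) ℂ}
    (hA : A.IsHermitian) (hA1 : ‖A‖ ≤ 1) (hAr : A.rank ≤ r) {V : Matrix (Fin n) (Fin k) ℂ} {κ : ℝ}
    (hV : NearIsometry V κ) (hκ0 : 0 ≤ κ) (hκ : κ ≤ 1 / 4) :
    frobNorm A ^ 2 * (frobNorm V ^ 2) ^ 2 ≤ 4 * (r : ℝ) ^ 3 := by
  have hR : (1 : ℝ) ≤ r := by exact_mod_cast hr
  have hK : (k : ℝ) ≤ r := by exact_mod_cast hk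
  have h1 := frobNorm_sq_le_of_rank_le hA hA1 hAr
  have h3 : frobNorm V ^ 2 ≤ 2 * r := by
    have hsq : √(k : ℝ) ^ 2 = k := Real.sq_sqrt (Nat.cast_nonneg k)
    have hs0 := Real.sqrt_nonneg (k : ℝ)
    have hs1 : √(k : ℝ) ≤ r := by
      rw [Real.sqrt_le_left (by linarith)]; nlinarith
    have h4 := pow_le_pow_left₀ (frobNorm_nonneg _) hV.frobNorm_le 2
    have h5 : √(k : ℝ) * κ ≤ r * (1 / 4) := mul_le_mul hs1 hκ hκ0 (by linarith)
    have h6 : κ ^ 2 ≤ (1 / 4) ^ 2 := pow_le_pow_left₀ hκ0 hκ 2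
    rw [add_sq, hsq] at h4
    linarith
  calc _ ≤ (r : ℝ) * (2 * r) ^ 2 := by gcongr
    _ = 4 * (r : ℝ) ^ 3 := by ring

/-- The failure probability after sufficiently many samples. -/
theorem failure_le {R t es δ : ℝ} (hR : 0 < R) {τ h M : ℕ} (ht : t = τ) (hτ : 0 < t) (hes : 0 < es)
    (hgt : 2 < δ * 2 ^ h) (hM : h * (64 * R ^ 3 * t / es ^ 2) < M) :
    (Real.cosh (es / (16 * R ^ 3 * t) * (M * (es / 2))))⁻¹ *
      (1 + (es / (16 * R ^ 3 * t)) ^ 2 * (4 * R ^ 3)) ^ (τ * M) ≤ δ := by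
  set lam := es / (16 * R ^ 3 * t) with hlam
  have hlam0 : 0 < lam := by positivity
  have hpow : (1 + lam ^ 2 * (4 * R ^ 3)) ^ (τ * M) ≤
      Real.exp (M * (es ^ 2 / (64 * R ^ 3 * t))) := by
    calc (1 + lam ^ 2 * (4 * R ^ 3)) ^ (τ * M)
        ≤ Real.exp (lam ^ 2 * (4 * R ^ 3)) ^ (τ * M) := by
          refine pow_le_pow_left₀ (by positivity) ?_ _
          rw [add_comm]; exact Real.add_one_le_exp _
      _ = Real.exp (M * (es ^ 2 / (64 * R ^ 3 * t))) := by
          rw [← Real.exp_nat_mul]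
          congr 1
          push_cast
          rw [← ht, hlam]
          field_simp
          ring
  have hcosh : (Real.cosh (lam * (M * (es / 2))))⁻¹ ≤
      2 * Real.exp (-(2 * (M * (es ^ 2 / (64 * R ^ 3 * t))))) := by
    have h1 : lam * (M * (es / 2)) = 2 * (M * (es ^ 2 / (64 * R ^ 3 * t))) := by
      rw [hlam]; field_simp; ring
    rw [h1, Real.cosh_eq, Real.exp_neg]
    set x := Real.exp (2 * (M * (es ^ 2 / (64 * R ^ 3 * t))))
    have hx : 0 < x := Real.exp_pos _
    rw [inv_div, ← div_eq_mul_inv]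
    exact div_le_div_of_nonneg_left (by norm_num) hx (by linarith [inv_pos.2 hx])
  have hx : (h : ℝ) ≤ M * (es ^ 2 / (64 * R ^ 3 * t)) := by
    have h1 : 0 < 64 * R ^ 3 * t / es ^ 2 := by positivity
    have h2 := (lt_div_iff₀ h1).2 hM
    have h3 : (M : ℝ) / (64 * R ^ 3 * t / es ^ 2) = M * (es ^ 2 / (64 * R ^ 3 * t)) := by
      field_simp
    rw [h3] at h2
    exact h2.le
  have h2h : (2 : ℝ) ^ h ≤ Real.exp h := by
    rw [← mul_one (h : ℝ), Real.exp_nat_mul]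
    refine pow_le_pow_left₀ (by norm_num) ?_ _
    linarith [Real.add_one_le_exp (1 : ℝ)]
  set y := (M : ℝ) * (es ^ 2 / (64 * R ^ 3 * t))
  -- With this `λ` the moment grows by at most `e^y`, while the argument of `cosh` is `2y` and `1 /
  -- cosh z ≤ 2 e^(-z)`. The choice of `M` makes `y ≥ h`.
  calc _ ≤ 2 * Real.exp (-(2 * y)) * Real.exp y := by
        exact mul_le_mul hcosh hpow (by positivity) (by positivity)
    _ = 2 * (Real.exp y)⁻¹ := by
        rw [mul_assoc, ← Real.exp_add, ← Real.exp_neg]; congr 2; ring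
    _ ≤ 2 * ((2 : ℝ) ^ h)⁻¹ := by
        gcongr
        exact h2h.trans (Real.exp_le_exp.2 hx)
    _ ≤ δ := by
        rw [← div_eq_mul_inv, div_le_iff₀ (by positivity)]
        exact hgt.le

/-- The number of doublings that take `δ` above `2`. -/
theorem exists_doublings {δ : ℝ} (h0 : 0 < δ) (h1 : δ ≤ 1 / 2) :
    ∃ h : ℕ, (∀ i < h, δ * 2 ^ i ≤ 2) ∧ 2 < δ * 2 ^ h ∧ (h : ℝ) ≤ 5 * Real.log (1 / δ) := by
  classical
  have hex : ∃ h : ℕ, 2 < δ * 2 ^ h := by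
    obtain ⟨h, hh⟩ := pow_unbounded_of_one_lt (2 / δ) (by norm_num : (1 : ℝ) < 2)
    exact ⟨h, by rw [div_lt_iff₀ h0] at hh; linarith⟩
  refine ⟨Nat.find hex, fun i hi => not_lt.1 (Nat.find_min hex hi), Nat.find_spec hex, ?_⟩
  have hlog2 : Real.log 2 ≤ Real.log (1 / δ) :=
    Real.log_le_log (by norm_num) (by rw [le_div_iff₀ h0]; linarith)
  have hl := Real.log_two_gt_d9
  rcases Nat.eq_zero_or_pos (Nat.find hex) with hz | hpos
  · rw [hz]; push_cast; linarith
  have hle := not_lt.1 (Nat.find_min hex (Nat.sub_lt hpos one_pos))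
  set m := Nat.find hex - 1 with hm
  have hfind : (Nat.find hex : ℝ) = m + 1 := by
    rw [hm, Nat.cast_sub hpos]; simp
  -- Hence `m log 2 ≤ log 2 + log (1/δ) ≤ 2 log (1/δ)`; the extra 1 in `h = m + 1` is absorbed
  -- because `log (1/δ) ≥ log 2`.
  have h2 : (2 : ℝ) ^ m ≤ 2 * (1 / δ) := by
    rw [mul_one_div, le_div_iff₀ h0]; linarith
  have h3 := Real.log_le_log (by positivity) h2
  rw [Real.log_pow, Real.log_mul (by norm_num) (by positivity)] at h3
  rw [hfind]
  nlinarith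

/-- `G` stands for `r³τ/ε_s²`. The dominant term is `t` matrices times `M` samples times `R²`
accumulator entries, which leaves a factor `t` to spare in the bound. Since `R³ ≤ G`, the
diagonalisation time is absorbed as well. -/
theorem time_le {R K p L t G Λ h M : ℝ} (hR : 1 ≤ R) (hK0 : 0 ≤ K) (hK : K ≤ R) (hp : 1 ≤ p)
    (hL : 0 ≤ L) (ht : 1 ≤ t) (hG : R ^ 3 ≤ G) (hΛ : 1 / 2 ≤ Λ) (hh : h ≤ 5 * Λ)
    (hM : M ≤ h * (64 * G) + 1) :
    42 + 3 * h + 3 * M + t * (1 + (M * (6 + 3 * L + (17 + L + K * (12 + 2 * p) +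
      K * K * (12 + 4 * p))) + 3)) + K ^ 3 ≤ 20000 * ((p + L) * (R ^ 2 * t ^ 2 * G) * Λ) := by
  have hR3 : 1 ≤ R ^ 3 := one_le_pow₀ hR
  have hG1 : 1 ≤ G := hR3.trans hG
  have hMG : M ≤ 322 * (G * Λ) := by nlinarith
  set P := p + L with hP
  have hP1 : 1 ≤ P := by linarith
  have hR2 : 1 ≤ R ^ 2 := one_le_pow₀ hR
  have hinner : 6 + 3 * L + (17 + L + K * (12 + 2 * p) + K * K * (12 + 4 * p)) ≤
      57 * (R ^ 2 * P) := by
    have e1 : K * (12 + 2 * p) ≤ R ^ 2 * (14 * P) :=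
      mul_le_mul (by nlinarith) (by linarith) (by linarith) (by linarith)
    have e2 : K * K * (12 + 4 * p) ≤ R ^ 2 * (16 * P) :=
      mul_le_mul (by nlinarith) (by linarith) (by linarith) (by linarith)
    have e3 : 23 + 4 * L ≤ R ^ 2 * (27 * P) := by nlinarith
    linarith
  have hGΛ : 1 / 2 ≤ G * Λ := by nlinarith
  have hGΛ0 : 0 ≤ G * Λ := by linarith
  have hRP : 1 ≤ R ^ 2 * P := one_le_mul_of_one_le_of_one_le hR2 hP1
  have hRPt : 1 ≤ R ^ 2 * P * t := one_le_mul_of_one_le_of_one_le hRP ht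
  set X := R ^ 2 * P * t * t * (G * Λ) with hX
  have hXeq : 20000 * (P * (R ^ 2 * t ^ 2 * G) * Λ) = 20000 * X := by rw [hX]; ring
  have b1 : R ^ 2 * P * t * (G * Λ) ≤ X := by
    rw [hX]
    exact mul_le_mul_of_nonneg_right (le_mul_of_one_le_right (by linarith) ht) hGΛ0
  have b2 : G * Λ ≤ X := (le_mul_of_one_le_left hGΛ0 hRPt).trans b1
  have b3 : t ≤ 2 * X := by
    have : t * (1 / 2) ≤ R ^ 2 * P * t * (G * Λ) :=
      mul_le_mul (le_mul_of_one_le_left (by linarith) hRP) hGΛ (by norm_num) (by linarith)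
    linarith
  have b4 : t * (M * (6 + 3 * L + (17 + L + K * (12 + 2 * p) + K * K * (12 + 4 * p)))) ≤
      18354 * X := by
    calc _ ≤ t * (322 * (G * Λ) * (57 * (R ^ 2 * P))) := by
          refine mul_le_mul_of_nonneg_left (mul_le_mul hMG hinner ?_ (by linarith)) (by linarith)
          positivity
      _ = 18354 * (R ^ 2 * P * t * (G * Λ)) := by ring
      _ ≤ 18354 * X := by linarith
  have b5 : K ^ 3 ≤ 2 * X := by
    have : K ^ 3 ≤ R ^ 3 := pow_le_pow_left₀ hK0 hK 3
    nlinarith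
  have b6 : h ≤ 5 * X := by nlinarith
  rw [hXeq]
  linarith

/-- The alternative `v ≤ 0` covers runs that end with a bad accumulator: there the claimed lower
bound is vacuous for a nonnegative indicator. -/
theorem triple_approximate_start {n τ k r : ℕ} {ε δ : ℝ} (hτ : 1 ≤ τ) (hr : 1 ≤ r) (hk : k ≤ r)
    (hε : 0 < ε) (hε1 : ε ≤ 1) (hδ : 0 < δ) (hδ1 : δ ≤ 1 / 2) (O : Access n τ k) (hp : 1 ≤ O.p)
    (hA : ∀ l, (O.A l).IsHermitian) (hA1 : ∀ l, ‖O.A l‖ ≤ 1) (hAr : ∀ l, (O.A l).rank ≤ r)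
    (hV : NearIsometry O.V (ε / (300 * (r : ℝ) ^ 2 * ((τ : ℝ) + 1)))) :
    ∃ fuel, Triple O fuel .approximate (State.start n τ k r ε δ) (1 - δ) fun s v =>
      v ≤ 0 ∨ v ≤ 1 ∧ (s.result k).IsHermitian ∧
        frobNorm (O.Vᴴ * (∑ l, O.A l) * O.V - s.result k) ≤ ε / (400 * (r : ℝ) ^ 2) ∧
        s.t + (k : ℝ) ^ 3 ≤ 20000 * (((O.p : ℝ) + Real.log n) *
              ((r : ℝ) ^ 5 * (τ : ℝ) ^ 3 / (ε / (400 * (r : ℝ) ^ 2)) ^ 2) * Real.log (1 / δ)) := by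
  have hR : (1 : ℝ) ≤ r := by exact_mod_cast hr
  have hT : (1 : ℝ) ≤ τ := by exact_mod_cast hτ
  have hK : (k : ℝ) ≤ r := by exact_mod_cast hk
  have hP : (1 : ℝ) ≤ O.p := by exact_mod_cast hp
  have hR2 : (1 : ℝ) ≤ (r : ℝ) ^ 2 := one_le_pow₀ hR
  have hL := Real.log_natCast_nonneg n
  obtain ⟨h, hlt, hgt, hh⟩ := exists_doublings hδ hδ1
  have hΛ : 1 / 2 ≤ Real.log (1 / δ) := by
    have h1 : Real.log 2 ≤ Real.log (1 / δ) :=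
      Real.log_le_log (by norm_num) (by rw [le_div_iff₀ hδ]; linarith)
    linarith [Real.log_two_gt_d9]
  set es := ε / (400 * (r : ℝ) ^ 2) with hes
  have hes0 : 0 < es := by positivity
  have hes1 : es ≤ 1 := by rw [hes, div_le_one (by positivity)]; linarith
  set α : ℝ := 64 * r ^ 3 * τ / es ^ 2 with hα
  have hα' : (64 * r ^ 3 * τ * (400 * r ^ 2 / ε) ^ 2 : ℝ) = α := by
    rw [hα, hes]; field_simp
  have hα0 : 0 < α := by positivity
  -- This `B` makes the total bias `τ · 4r³ / B` equal to `es / 2`. Below, `lam` is the largest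
  -- value allowed by `2 * lam * B ≤ 1`.
  set B : ℝ := 8 * r ^ 3 * τ / es with hB
  have hB0 : 0 < B := by positivity
  have hB' : (64 * r ^ 6 * τ ^ 2 * (400 * r ^ 2 / ε) ^ 2 : ℝ) = B ^ 2 := by
    rw [hB, hes]; field_simp; ring
  set M : ℕ := ⌊h * α⌋₊ + 1 with hM
  have hhα : 0 ≤ h * α := by positivity
  have Mlt : ∀ m < M, (m : ℝ) ≤ h * α := fun m hm =>
    (Nat.le_floor_iff hhα).1 (Nat.lt_succ_iff.1 hm)
  have Mgt : h * α < M := by rw [hM]; push_cast; exact Nat.lt_floor_add_one _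
  have Mle : (M : ℝ) ≤ h * α + 1 := by
    rw [hM]; push_cast; linarith [Nat.floor_le hhα]
  have hM0 : 0 < M := Nat.succ_pos _
  set lam : ℝ := es / (16 * r ^ 3 * τ) with hlam
  have hlam0 : 0 < lam := by positivity
  have hlB : 2 * lam * B ≤ 1 := by
    rw [hlam, hB]
    refine le_of_eq ?_
    field_simp; norm_num
  have hσ : ∀ l, frobNorm (O.A l) ^ 2 * (frobNorm O.V ^ 2) ^ 2 ≤ 4 * (r : ℝ) ^ 3 := by
    intro l
    refine variance_le hr hk (hA l) (hA1 l) (hAr l) hV (by positivity) ?_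
    rw [div_le_iff₀ (by positivity)]
    nlinarith
  have hγ0 : 0 ≤ (Real.cosh (lam * (M * (es / 2))))⁻¹ := (inv_pos.2 (Real.cosh_pos _)).le
  -- More than the number of rounds of any single loop.
  refine ⟨k + τ + h + M + 1, ?_⟩
  refine (triple_approximate (M := M) (by omega) (by omega) (by omega) (by omega) hlt hgt
    (by rw [hα']; exact Mlt) (by rw [hα']; exact Mgt)
    (potential O (B ^ 2) lam (1 + lam ^ 2 * (4 * (r : ℝ) ^ 3))
      (Real.cosh (lam * (M * (es / 2))))⁻¹ M) ?_ (fun l S _ => potential_next _ _ _ _)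
    (fun l m S hm hF => potential_le_of_frobNorm_eq_zero (by positivity) hγ0 l S hm hF)
    (fun l m S hm hF => ?_)).mono ?_
  · have hfail := failure_le (by linarith : (0 : ℝ) < r) (τ := τ) rfl (by linarith) hes0 hgt Mgt
    rw [potential, meanSum]
    simp only [Nat.cast_zero, zero_smul, Finset.range_zero, Finset.sum_empty, smul_zero, add_zero,
      sub_self, frobNorm_zero, mul_zero, Real.cosh_zero, mul_one, Nat.sub_zero]
    linarith
  · rw [hB']
    exact potential_le (by positivity) hγ0 hB0.le hlam0.le hlB l (hσ l) S hm hF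
  · rintro s v ⟨hx0, ⟨S, ⟨hS, hacc⟩, hv⟩, ht⟩
    rcases le_or_gt v 0 with hv0 | hv0
    · exact Or.inl hv0
    have hres : s.result k = (M : ℝ)⁻¹ • S := by
      ext i j
      rw [State.result, Matrix.of_apply, hx0, hacc, Matrix.smul_apply, Complex.real_smul]
      push_cast
      rw [div_eq_inv_mul]
    refine Or.inr ⟨hv.trans ?_, ?_, ?_, ?_⟩
    · rw [potential]
      have : 0 ≤ (Real.cosh (lam * (M * (es / 2))))⁻¹ * (1 + lam ^ 2 * (4 * (r : ℝ) ^ 3)) ^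
        ((τ - τ) * M - 0) * Real.cosh (lam * frobNorm (S - meanSum O (B ^ 2) M τ 0)) := by
        positivity
      linarith
    · rw [hres, Matrix.IsHermitian, Matrix.conjTranspose_smul, hS.eq, star_trivial]
    · rw [hres]
      refine (frobNorm_sub_smul_le hA hB0 hσ hM0 (frobNorm_le_of_potential_pos hlam0
        (by positivity) S (hv0.trans_le hv))).trans (le_of_eq ?_)
      rw [hB]
      field_simp
      ring
    · have hG : (r : ℝ) ^ 3 ≤ r ^ 3 * τ / es ^ 2 := by
        rw [le_div_iff₀ (by positivity)]
        have : es ^ 2 ≤ 1 := pow_le_one₀ hes0.le hes1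
        have h3 : (0 : ℝ) < (r : ℝ) ^ 3 := by positivity
        exact mul_le_mul_of_nonneg_left (this.trans hT) h3.le
      have htime := time_le (h := h) (M := M) hR (Nat.cast_nonneg k) hK hP hL hT hG hΛ hh
        (Mle.trans_eq (by rw [hα]; ring))
      have e : (r : ℝ) ^ 5 * τ ^ 3 / es ^ 2 = r ^ 2 * τ ^ 2 * (r ^ 3 * τ / es ^ 2) := by ring
      rw [e]
      rw [matrixTime, entryTime] at ht
      linarith

end SymApprox

theorem lemma3p4 :
    ∃ (P : SymApprox.Prog) (C : ℝ), 0 < C ∧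
      ∀ (n τ k r : ℕ) (ε δ : ℝ), 1 ≤ n → 1 ≤ τ → 1 ≤ r → k ≤ r →
        0 < ε → ε ≤ 1 → 0 < δ → δ ≤ 1 / 2 →
        ∀ O : SymApprox.Access n τ k, 1 ≤ O.p →
          (∀ ℓ, (O.A ℓ).IsHermitian) → (∀ ℓ, ‖O.A ℓ‖ ≤ 1) → (∀ ℓ, (O.A ℓ).rank ≤ r) →
          SymApprox.NearIsometry O.V (ε / (300 * (r : ℝ) ^ 2 * ((τ : ℝ) + 1))) →
          SymApprox.frobNorm (O.V * O.Vᴴ * (∑ ℓ, O.A ℓ) * O.V * O.Vᴴ - ∑ ℓ, O.A ℓ) ≤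
            ε / (300 * (r : ℝ) ^ 2) * (2 + ε / (300 * (r : ℝ) ^ 2 * ((τ : ℝ) + 1))) →
          P.Succeeds O r ε δ (1 - δ)
            (C * (((O.p : ℝ) + Real.log n) *
              ((r : ℝ) ^ 5 * (τ : ℝ) ^ 3 / (ε / (400 * (r : ℝ) ^ 2)) ^ 2) * Real.log (1 / δ)))
            (fun B U D =>
              B.IsHermitian ∧
              U ∈ Matrix.unitaryGroup (Fin k) ℂ ∧
              B = U * Matrix.diagonal (fun i => (D i : ℂ)) * Uᴴ ∧
              SymApprox.frobNorm (O.Vᴴ * (∑ ℓ, O.A ℓ) * O.V - B) ≤ ε / (400 * (r : ℝ) ^ 2) ∧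
              ‖O.V * B * O.Vᴴ - ∑ ℓ, O.A ℓ‖ ≤
                (1 + ε / (300 * (r : ℝ) ^ 2 * ((τ : ℝ) + 1))) ^ 2 * (ε / (400 * (r : ℝ) ^ 2)) +
                (2 + ε / (300 * (r : ℝ) ^ 2 * ((τ : ℝ) + 1))) * (ε / (300 * (r : ℝ) ^ 2)) ∧
              ‖(O.V * U) * Matrix.diagonal (fun i => (D i : ℂ)) * (O.V * U)ᴴ - ∑ ℓ, O.A ℓ‖ ≤
                (1 + ε / (300 * (r : ℝ) ^ 2 * ((τ : ℝ) + 1))) ^ 2 * (ε / (400 * (r : ℝ) ^ 2)) +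
                (2 + ε / (300 * (r : ℝ) ^ 2 * ((τ : ℝ) + 1))) * (ε / (300 * (r : ℝ) ^ 2)) ∧
              SymApprox.NearIsometry (O.V * U)
                (ε / (300 * (r : ℝ) ^ 2 * ((τ : ℝ) + 1)))) := by
  refine ⟨.approximate, 20000, by norm_num, ?_⟩
  intro n τ k r ε δ _ hτ hr hk hε hε1 hδ hδ1 O hp hA hA1 hAr hV hVA
  obtain ⟨fuel, hT⟩ := SymApprox.triple_approximate_start hτ hr hk hε hε1 hδ hδ1 O hp hA hA1 hAr hV
  refine ⟨fuel, hT _ fun s v hv => ?_⟩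
  -- If the bound carried is nonpositive, either value of the indicator suffices; otherwise the
  -- output is good and the indicator is 1.
  rcases hv with hv | ⟨hv, hH, hfrob, ht⟩
  · split_ifs
    exacts [hv.trans zero_le_one, hv]
  · have hspec : s.result k = (hH.eigenvectorUnitary : Matrix (Fin k) (Fin k) ℂ) *
        Matrix.diagonal (fun i => (hH.eigenvalues i : ℂ)) *
          (hH.eigenvectorUnitary : Matrix (Fin k) (Fin k) ℂ)ᴴ := hH.spectral_theorem
    have hnorm := SymApprox.norm_compress_sub_le hV hfrob hVA
    rw [mul_comm (ε / (300 * (r : ℝ) ^ 2))] at hnorm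
    rw [if_pos]
    · exact hv
    · refine ⟨hH, ht, hH, hH.eigenvectorUnitary.2, hspec, hfrob, hnorm, ?_,
        hV.mul_unitary hH.eigenvectorUnitary.2⟩
      convert hnorm using 3
      conv_rhs => rw [hspec]
      simp only [Matrix.conjTranspose_mul, Matrix.mul_assoc]
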